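/- Let $p\ge 1$ be an integer. For positive integers $n,m$ and $N_0>0$, let $\mathbf X$ be an $n\times m$ matrix with i.i.d. circularly symmetric complex Gaussian entries of mean $0$ and variance $N_0$, and let $$W_0=\frac{\frac1n\operatorname{Tr}(\mathbf X\mathbf X^\dagger)}{\det(\mathbf X\mathbf X^\dagger)^{1/n}},\qquad c=\frac nm .$$ If $c\in(0,1)$ and $p<n(m-n+1)$, then the $p$-th moment $\mu_{W_0,p}=\mathrm E[W_0^p]$ is finite, and for large $n$ it admits the asymptotic expansion $$\mu_{W_0,p}\sim\sum_{j=0}^\infty\frac{\beta_{p,j}(c)}{n^{2j}},\qquad \ln\mu_{W_0,p}\sim\sum_{q=0}^\infty\frac{A_{p,q}(c)}{n^{2q}},$$ in the following sense: for all $0<a\le b<1$ and every integer $N\ge0$ there is a constant $C=C(p,a,b,N)$ such that for all $n,m$ with $a\le c=n/m\le b$ and $p<n(m-n+1)$, and all $N_0>0$, $$\Big|\mu_{W_0,p}-\sum_{j=0}^{N}\frac{\beta_{p,j}(c)}{n^{2j}}\Big|\le\frac{C}{n^{2(N+1)}},\qquad \Big|\ln\mu_{W_0,p}-\sum_{q=0}^{N}\frac{A_{p,q}(c)}{n^{2q}}\Big|\le\frac{C}{n^{2(N+1)}}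 .$$ Here $\beta_{p,0}(c)=e^{A_{p,0}(c)}$ and, for $j>0$, $$\beta_{p,j}(c)=e^{A_{p,0}(c)}\sum_{i_1+2i_2+\cdots+j i_j=j}\ \prod_{r=1}^j\frac{A_{p,r}(c)^{i_r}}{i_r!},$$ the sum being over the non-negative integer solutions of $i_1+2i_2+\cdots+j i_j=j$; the coefficients $A_{p,q}(c)$ are $$A_{p,0}(c)=p-p\Big(1-\frac1c\Big)\log(1-c),$$ $$A_{p,1}(c)=-\frac{p^2}{2}\log(1-c)+\frac{cp\,(12-11c+6(1-p)(c-1))}{12(c-1)},$$ and, for $q>1$, $$A_{p,q}(c)=\frac{(cp)^q(c+12p-12cp-cq^2)}{12cq(q^2-1)(1-c)^q}+\frac{(cp)^q(-12p+c(q^2-1))}{12cq(q^2-1)}-\frac{c^q}{q}H_{p,-q}+\sum_{j=1}^{q-1}\frac{B_{2j+2}\,c^{2j}\,(2j)_{q-j}\,(pc)^{q-j}}{4j(j+1)(q-j)!}\Big(1-(1-c)^{-j-q}\Big),$$ where $H_{p,-q}=\sum_{k=1}^p k^q$ is a generalized harmonic number, $B_k$ are the Bernoulli numbers and $(x)_r=x(x+1)\cdots(x+r-1)$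 is the rising factorial. -/

import Mathlib

open MeasureTheory ProbabilityTheory
open scoped NNReal Matrix

noncomputable section

/-- The circularly symmetric complex Gaussian law `CN(0, v)` on `ℂ`: real and imaginary parts are
independent real Gaussians of mean `0` and variance `v / 2`, so that `E |z|² = v`. -/
def complexGaussian (v : ℝ≥0) : Measure ℂ :=
  ((gaussianReal 0 (v / 2)).prod (gaussianReal 0 (v / 2))).map
    (fun z : ℝ × ℝ => (z.1 : ℂ) + (z.2 : ℂ) * Complex.I)

/-- The law `CN_{n,m}(0, v I_n)` of (the array of entries of) an `n × m` random matrix whose columns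
are i.i.d. `CN_{n,1}(0, v I_n)`, that is, whose entries are i.i.d. `CN(0, v)`. -/
def complexGaussianMatrix (n m : ℕ) (v : ℝ≥0) : Measure (Fin n → Fin m → ℂ) :=
  Measure.pi fun _ : Fin n => Measure.pi fun _ : Fin m => complexGaussian v

/-- The sphericity statistic `(Tr(X Xᴴ) / n) / det(X Xᴴ)^(1/n)`.  The trace and the determinant of
the positive semidefinite matrix `X Xᴴ` are nonnegative reals. -/
def sphericityStat {n m : ℕ} (X : Matrix (Fin n) (Fin m) ℂ) : ℝ :=
  ((X * Xᴴ).trace.re / (n : ℝ)) / (X * Xᴴ).det.re ^ (1 / (n : ℝ))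

/-- The `p`-th moment `E[W₀^p]` of the sphericity statistic `W₀` of `X ∼ CN_{n,m}(0, N₀ I_n)`. -/
def momentW0 (n m : ℕ) (N₀ : ℝ≥0) (p : ℕ) : ℝ :=
  ∫ X : Fin n → Fin m → ℂ, sphericityStat (Matrix.of X) ^ p ∂(complexGaussianMatrix n m N₀)

/-- The generalized harmonic number `H_{a,b} = ∑_{k=1}^a 1 / k^b`, for an integer order `b`. -/
def genHarmonic (a : ℕ) (b : ℤ) : ℝ :=
  ∑ k ∈ Finset.Icc 1 a, 1 / (k : ℝ) ^ b

/-- The coefficients `A_{p,q}(c)`.  The symbol `(2j)_{q-j}` is the rising factorial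
`2j (2j+1) ⋯ (2j+(q-j)-1)`. -/
def coeffA (p : ℕ) (c : ℝ) (q : ℕ) : ℝ :=
  if q = 0 then
    p - p * (1 - 1 / c) * Real.log (1 - c)
  else if q = 1 then
    -(p : ℝ) ^ 2 / 2 * Real.log (1 - c)
      + c * p * (12 - 11 * c + 6 * (1 - p) * (c - 1)) / (12 * (c - 1))
  else
    (c * p) ^ q * (c + 12 * p - 12 * c * p - c * (q : ℝ) ^ 2)
        / (12 * c * q * (-1 + (q : ℝ) ^ 2) * (1 - c) ^ q)
      + (c * p) ^ q * (-12 * p + c * (-1 + (q : ℝ) ^ 2)) / (12 * c * q * (-1 + (q : ℝ) ^ 2))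
      - c ^ q / q * genHarmonic p (-(q : ℤ))
      + ∑ j ∈ Finset.Icc 1 (q - 1),
          (bernoulli (2 * j + 2) : ℝ) * c ^ (2 * j)
              * (ascPochhammer ℝ (q - j)).eval (2 * (j : ℝ)) * (p * c) ^ (q - j)
            / (4 * j * (j + 1) * ((q - j).factorial : ℝ))
            * (1 - ((1 - c) ^ (j + q))⁻¹)

/-- The nonnegative integer solutions `(i_1, …, i_j)` of `i_1 + 2 i_2 + ⋯ + j i_j = j`, with
`i_{r+1}` stored at `r : Fin j` (every solution has all its entries at most `j`). -/
def weightedSolutions (j : ℕ) : Finset (Fin j → ℕ) :=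
  (Fintype.piFinset fun _ : Fin j => Finset.range (j + 1)).filter
    fun i => ∑ r : Fin j, ((r : ℕ) + 1) * i r = j

/-- The coefficients `β_{p,j}(c)`:  `e^{A_{p,0}(c)}` for `j = 0`, and for `j > 0`
`e^{A_{p,0}(c)} ∑_{i_1 + 2 i_2 + ⋯ + j i_j = j} ∏_{r=1}^j A_{p,r}(c)^{i_r} / i_r!`. -/
def coeffBeta (p : ℕ) (c : ℝ) (j : ℕ) : ℝ :=
  if j = 0 then
    Real.exp (coeffA p c 0)
  else
    Real.exp (coeffA p c 0) *
      ∑ i ∈ weightedSolutions j,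
        ∏ r : Fin j, coeffA p c ((r : ℕ) + 1) ^ i r / ((i r).factorial : ℝ)

end

/-!
The moment has a closed form. Put `s = p / n`. Since `W₀` is homogeneous of degree `0` in `X`, it
is independent of the trace, so that `E[Tr^p det^(-s)]` is `E[det^(-s)]` times the elementary factor
`∏_{k=1}^p N₀ (n m - k)` (`lintegral_gramTrace_pow_mul`; no polar coordinates are needed, only a
rescaling of `exp (-q) / q = ∫_{l > 1} exp (-l q)`). The Gram determinant is built row by row, each
row contributing its squared distance to the span of the others (`gramDet_cons`), which is a Gamma
variable (`lintegral_rpow_norm_starProjection`). With `m = r + n`, this gives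
`E[W₀^p] = ∏_{k=1}^p (m - k / n) * ∏_{r ≤ x < m} Γ (x + 1 - s) / Γ (x + 1)`, the `momentFormula`;
the condition `p < n (m - n + 1)` says exactly that the Gamma functions have positive arguments.

For the asymptotics, let `F` be a function whose first difference is
`g x = log Γ (x + 1 - s) - log Γ (x + 1)`. Its central second difference is `log (1 - s / x)`, and
`g x + s log x → 0` at infinity; these two facts determine `g`. Expanding `log (1 - s / x)` in powers
of `s / x` and inverting the second difference operator `4 sinh² (D / 2)` through the
Bernoulli numbers (`sum_sinhCoeff`, `abs_second_diff_secondSum_le`) gives an explicit approximate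
solution `gammaSum`, with an error that is summable down from infinity
(`abs_log_Gamma_sub_diff_gammaSum_le`). As `s ~ 1 / n` and `x ~ n`, the terms of
`gammaSum m - gammaSum r` group into even powers of `1 / n`, which together with the expansion of
`∏ (m - k / n)` are the `coeffA p c q / n ^ (2 q)` (`sum_coeffA_eq`). All this is uniform for `n`
large and `c ≤ b < 1`; the condition `a ≤ c` leaves finitely many pairs `(n, m)` with `n` small.
Finally the expansion of `log μ` is exponentiated, the coefficients of `exp (∑ A_q y^q)` being sums
over weighted multi-indices (`abs_exp_sub_sum_weightedSolutions_le`).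
-/

noncomputable section

/-! ### The Taylor coefficients of `t² / (4 sinh² (t / 2))` -/

/-- The Taylor coefficients `(1 - 2i) B_{2i} / (2i)!` of the even function
`t² / (4 sinh² (t / 2)) = ∑ i, sinhCoeff i * t ^ (2 * i)`. -/
def sinhCoeff (i : ℕ) : ℝ :=
  (1 - 2 * (i : ℝ)) * (bernoulli (2 * i) : ℝ) / ((2 * i).factorial : ℝ)

lemma sum_range_two_mul_of_odd_zero {M : Type*} [AddCommMonoid M] (f : ℕ → M)
    (hf : ∀ i, f (2 * i + 1) = 0) (n : ℕ) :
    ∑ a ∈ Finset.range (2 * n + 1), f a = ∑ i ∈ Finset.range (n + 1), f (2 * i) := by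
  induction n with
  | zero => simp
  | succ n ih =>
    rw [show 2 * (n + 1) + 1 = 2 * n + 1 + 1 + 1 by ring, Finset.sum_range_succ,
      Finset.sum_range_succ, ih, hf, add_zero, Finset.sum_range_succ _ (n + 1)]
    rfl

/-- With `B = t / (e^t - 1)` one has `t² / (4 sinh² (t / 2)) = B - t B'`. -/
lemma bernoulliPowerSeries_sub_X_mul_derivative :
    (bernoulliPowerSeries ℝ - PowerSeries.X * PowerSeries.derivative ℝ (bernoulliPowerSeries ℝ))
      * (PowerSeries.exp ℝ + PowerSeries.evalNegHom (PowerSeries.exp ℝ) - 2)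
      = PowerSeries.X ^ 2 := by
  have h1 := bernoulliPowerSeries_mul_exp_sub_one ℝ
  have h2 := congrArg (PowerSeries.derivative ℝ) h1
  have h3 := PowerSeries.exp_mul_exp_neg_eq_one (A := ℝ)
  have h4 : PowerSeries.derivative ℝ (PowerSeries.exp ℝ) = PowerSeries.exp ℝ := by
    ext n
    simp [PowerSeries.coeff_derivative, PowerSeries.coeff_exp, Nat.factorial_succ]
    field_simp
  rw [Derivation.leibniz, map_sub, h4, PowerSeries.derivative_X] at h2
  simp only [smul_eq_mul, Derivation.map_one_eq_zero, sub_zero] at h2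
  set B := bernoulliPowerSeries ℝ
  set B' := PowerSeries.derivative ℝ B
  set e := PowerSeries.exp ℝ
  set e' := PowerSeries.evalNegHom e
  have h5 : e + e' - 2 = (e - 1) ^ 2 * e' := by linear_combination (-e + 2) * h3
  have h6 : (B - PowerSeries.X * B') * (e - 1) = PowerSeries.X * B * e := by
    linear_combination h1 - PowerSeries.X * h2
  rw [h5]
  linear_combination (e - 1) * e' * h6 + PowerSeries.X * B * (e - 1) * h3 + PowerSeries.X * h1

/-- The product of the Taylor series of `t² / (4 sinh² (t / 2))` and of `4 sinh² (t / 2)` is `t²`. -/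
lemma sum_sinhCoeff (j : ℕ) :
    ∑ i ∈ Finset.range (j + 1), sinhCoeff i * (2 / ((2 * (j + 1 - i)).factorial : ℝ))
      = if j = 0 then 1 else 0 := by
  have h := congrArg (PowerSeries.coeff (2 * (j + 1))) bernoulliPowerSeries_sub_X_mul_derivative
  have hC2 : (2 : PowerSeries ℝ) = PowerSeries.C 2 := (map_ofNat PowerSeries.C 2).symm
  have hE : ∀ a, PowerSeries.coeff a (bernoulliPowerSeries ℝ -
      PowerSeries.X * PowerSeries.derivative ℝ (bernoulliPowerSeries ℝ))
      = (1 - (a : ℝ)) * (bernoulli a : ℝ) / (a.factorial : ℝ) := by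
    intro a
    cases a with
    | zero => simp [bernoulliPowerSeries]
    | succ a =>
      simp [bernoulliPowerSeries, PowerSeries.coeff_succ_X_mul, PowerSeries.coeff_derivative]
      ring
  rw [PowerSeries.coeff_mul, Finset.Nat.sum_antidiagonal_eq_sum_range_succ_mk] at h
  simp only [hE] at h
  rw [Nat.succ_eq_add_one, sum_range_two_mul_of_odd_zero, Finset.sum_range_succ] at h
  · have h0 : PowerSeries.coeff (2 * (j + 1) - 2 * (j + 1)) (PowerSeries.exp ℝ +
        PowerSeries.evalNegHom (PowerSeries.exp ℝ) - 2) = 0 := by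
      rw [hC2, Nat.sub_self]
      simp only [PowerSeries.evalNegHom, map_sub, map_add, PowerSeries.coeff_rescale,
        PowerSeries.coeff_exp, PowerSeries.coeff_C]
      norm_num
    rw [h0, mul_zero, add_zero, PowerSeries.coeff_X_pow] at h
    have h1 : (2 * (j + 1) = 2) = (j = 0) := by simp
    simp only [h1] at h
    rw [← h]
    refine Finset.sum_congr rfl fun i hi => ?_
    have hi' : i < j + 1 := Finset.mem_range.mp hi
    have h2 : 2 * (j + 1) - 2 * i = 2 * (j + 1 - i) := by omega
    have h3 : 2 * (j + 1 - i) ≠ 0 := by omega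
    rw [h2, sinhCoeff]
    have h4 : PowerSeries.coeff (2 * (j + 1 - i)) (2 : PowerSeries ℝ) = 0 := by
      rw [hC2, PowerSeries.coeff_C, if_neg h3]
    simp [PowerSeries.evalNegHom, PowerSeries.coeff_rescale, PowerSeries.coeff_exp, h4]
    left
    ring
  · intro i
    rcases Nat.eq_zero_or_pos i with rfl | hi
    · simp
    · rw [bernoulli_eq_zero_of_odd (by simp) (by omega)]
      simp

/-! ### Inverting the second difference operator -/

/-- A function vanishing at `0` whose derivative is bounded by `B` on `[0, 1]` is bounded by `B`
there. -/
lemma abs_le_of_deriv_bound {f f' : ℝ → ℝ} {B : ℝ}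
    (hf : ∀ t ∈ Set.Icc (0 : ℝ) 1, HasDerivAt f (f' t) t) (h0 : f 0 = 0)
    (hB : ∀ t ∈ Set.Icc (0 : ℝ) 1, |f' t| ≤ B) : ∀ t ∈ Set.Icc (0 : ℝ) 1, |f t| ≤ B := by
  intro t ht
  have hB0 : 0 ≤ B := (abs_nonneg _).trans (hB 0 (by simp))
  have h := (convex_Icc (0 : ℝ) 1).norm_image_sub_le_of_norm_hasDerivWithin_le
    (fun s hs => (hf s hs).hasDerivWithinAt) (fun s hs => by simpa using hB s hs)
    (Set.left_mem_Icc.mpr zero_le_one) ht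
  rw [h0, sub_zero, sub_zero, Real.norm_eq_abs, Real.norm_eq_abs, abs_of_nonneg ht.1] at h
  nlinarith [ht.2]

/-- Symmetric Taylor expansion with remainder; `G l` plays the role of the `l`-th derivative
of `G 0`. -/
lemma abs_symm_taylor_le (M : ℕ) : ∀ (G : ℕ → ℝ → ℝ) (x B : ℝ), 1 < x →
    (∀ l y, 0 < y → HasDerivAt (G l) (G (l + 1) y) y) →
    (∀ y ∈ Set.Icc (x - 1) (x + 1), |G (2 * M) y| ≤ B) →
    ∀ t ∈ Set.Icc (0 : ℝ) 1, |G 0 (x + t) + G 0 (x - t)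
      - ∑ l ∈ Finset.range M, 2 * G (2 * l) x * (t ^ (2 * l) / ((2 * l).factorial : ℝ))|
      ≤ 2 * B := by
  induction M with
  | zero =>
    intro G x B hx hG hB t ht
    have h1 := hB (x + t) ⟨by linarith [ht.1], by linarith [ht.2]⟩
    have h2 := hB (x - t) ⟨by linarith [ht.2], by linarith [ht.1]⟩
    simp only [mul_zero] at h1 h2
    simp only [Finset.range_zero, Finset.sum_empty, sub_zero]
    exact (abs_add_le _ _).trans (by linarith)
  | succ M ih =>
    intro G x B hx hG hB
    have ih' := ih (fun l => G (l + 2)) x B hx (fun l y hy => hG (l + 2) y hy)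
      (fun y hy => hB y hy)
    have hpow : ∀ (a t : ℝ) (n : ℕ), HasDerivAt
        (fun t : ℝ => a * (t ^ (n + 1) / ((n + 1).factorial : ℝ)))
        (a * (t ^ n / (n.factorial : ℝ))) t := by
      intro a t n
      convert! ((hasDerivAt_pow (n + 1) t).div_const ((n + 1).factorial : ℝ)).const_mul a using 1
      have : (n.factorial : ℝ) ≠ 0 := by positivity
      rw [Nat.factorial_succ]
      push_cast
      field_simp
    have h1 := abs_le_of_deriv_bound (B := 2 * B)
      (f := fun t => G 1 (x + t) - G 1 (x - t)
        - ∑ l ∈ Finset.range M, 2 * G (2 * l + 2) x * (t ^ (2 * l + 1) / ((2 * l + 1).factorial : ℝ)))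
      (fun t ht => by
        have e1 := (hG 1 (x + t) (by linarith [ht.1])).comp_const_add x t
        have e2 := (hG 1 (x - t) (by linarith [ht.2])).comp_const_sub x t
        exact (e1.sub e2).sub (HasDerivAt.fun_sum fun l _ => hpow (2 * G (2 * l + 2) x) t (2 * l)))
      (by simp) (fun t ht => by simpa [sub_neg_eq_add] using ih' t ht)
    refine abs_le_of_deriv_bound (f := fun t => G 0 (x + t) + G 0 (x - t)
        - ∑ l ∈ Finset.range (M + 1), 2 * G (2 * l) x * (t ^ (2 * l) / ((2 * l).factorial : ℝ)))
      (fun t ht => ?_) ?_ h1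
    · have e1 := (hG 0 (x + t) (by linarith [ht.1])).comp_const_add x t
      have e2 := (hG 0 (x - t) (by linarith [ht.2])).comp_const_sub x t
      have e3 := (e1.add e2).sub ((HasDerivAt.fun_sum fun l (_ : l ∈ Finset.range M) =>
        hpow (2 * G (2 * l + 2) x) t (2 * l + 1)).add_const (2 * G 0 x))
      convert! e3 using 1
      funext t
      simp [Finset.sum_range_succ', mul_add]
    · simp [Finset.sum_range_succ']
      ring

/-- The central second difference of `G 0` through the even derivatives. -/
lemma abs_second_diff_le {G : ℕ → ℝ → ℝ} {x B : ℝ} (M : ℕ) (hx : 1 < x)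
    (hG : ∀ l y, 0 < y → HasDerivAt (G l) (G (l + 1) y) y)
    (hB : ∀ y ∈ Set.Icc (x - 1) (x + 1), |G (2 * (M + 1)) y| ≤ B) :
    |G 0 (x + 1) + G 0 (x - 1) - 2 * G 0 x
      - ∑ l ∈ Finset.range M, G (2 * (l + 1)) x * (2 / ((2 * (l + 1)).factorial : ℝ))| ≤ 2 * B := by
  have h := abs_symm_taylor_le (M + 1) G x B hx hG hB 1 (by simp)
  rw [Finset.sum_range_succ'] at h
  convert h using 2
  simp only [one_pow, mul_zero, Nat.factorial_zero, Nat.cast_one, div_one, mul_one]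
  rw [sub_add_eq_sub_sub_swap]
  congr 1
  exact Finset.sum_congr rfl fun l _ => by ring

/-- `invPowDeriv k l` is the `l`-th derivative of a second antiderivative of `x ↦ x⁻ᵏ` on
`(0, ∞)`; for `k = 1, 2` these antiderivatives are `x log x - x` and `-log x`.
The value at `k = 0` is irrelevant. -/
def invPowDeriv (k : ℕ) : ℕ → ℝ → ℝ
  | 0, x => if k = 1 then x * Real.log x - x else if k = 2 then -Real.log x
      else (x ^ (k - 2))⁻¹ / (((k : ℝ) - 1) * ((k : ℝ) - 2))
  | 1, x => if k = 1 then Real.log x else -((x ^ (k - 1))⁻¹ / ((k : ℝ) - 1))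
  | l + 2, x => (-1) ^ l * (ascPochhammer ℝ l).eval (k : ℝ) * (x ^ (k + l))⁻¹

lemma hasDerivAt_inv_pow (n : ℕ) {x : ℝ} (hx : 0 < x) :
    HasDerivAt (fun x : ℝ => (x ^ n)⁻¹) (-(n : ℝ) * (x ^ (n + 1))⁻¹) x := by
  convert! (hasDerivAt_pow n x).fun_inv (by positivity) using 1
  cases n with
  | zero => simp
  | succ n =>
    simp only [Nat.add_sub_cancel]
    field_simp
    ring

lemma hasDerivAt_invPowDeriv {k : ℕ} (hk : 1 ≤ k) (l : ℕ) {x : ℝ} (hx : 0 < x) :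
    HasDerivAt (invPowDeriv k l) (invPowDeriv k (l + 1) x) x := by
  match l with
  | 0 =>
    rcases Nat.lt_or_ge k 3 with h | h
    · interval_cases k
      · have := ((Real.hasDerivAt_mul_log hx.ne').sub (hasDerivAt_id x))
        convert! this using 1
        simp [invPowDeriv]
      · convert! (Real.hasDerivAt_log hx.ne').fun_neg using 1
        simp [invPowDeriv]
        norm_num
    · obtain ⟨j, rfl⟩ := Nat.exists_eq_add_of_le h
      have := (hasDerivAt_inv_pow (3 + j - 2) hx).div_const
        ((((3 + j : ℕ) : ℝ) - 1) * (((3 + j : ℕ) : ℝ) - 2))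
      have e1 : 3 + j ≠ 1 := by omega
      have e2 : 3 + j ≠ 2 := by omega
      have e3 : 3 + j - 2 = j + 1 := by omega
      have e4 : 3 + j - 1 = j + 2 := by omega
      have e5 : (3 : ℝ) + j - 1 ≠ 0 := by have : (0 : ℝ) ≤ j := j.cast_nonneg; linarith
      have e6 : (3 : ℝ) + j - 2 ≠ 0 := by have : (0 : ℝ) ≤ j := j.cast_nonneg; linarith
      convert! this using 1
      · funext y
        simp [invPowDeriv, e1, e2]
      · simp [invPowDeriv, e1, e3, e4]
        field_simp
        ring
  | 1 =>
    rcases Nat.eq_or_lt_of_le hk with h | h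
    · subst h
      convert! (Real.hasDerivAt_log hx.ne') using 1
      simp [invPowDeriv]
    · have := ((hasDerivAt_inv_pow (k - 1) hx).div_const ((k : ℝ) - 1)).fun_neg
      have e1 : k ≠ 1 := by omega
      have e2 : (k : ℝ) - 1 ≠ 0 := by
        have : (1 : ℝ) < k := by exact_mod_cast h
        linarith
      convert! this using 1
      · funext y
        simp [invPowDeriv, e1]
      · rw [Nat.sub_add_cancel hk, Nat.cast_sub hk]
        simp [invPowDeriv]
        field_simp
        ring
  | l + 2 =>
    have := (hasDerivAt_inv_pow (k + l) hx).const_mul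
      ((-1) ^ l * (ascPochhammer ℝ l).eval (k : ℝ))
    convert! this using 1
    simp only [invPowDeriv]
    rw [ascPochhammer_succ_eval]
    push_cast
    ring_nf

lemma invPowDeriv_two (k : ℕ) (x : ℝ) : invPowDeriv k 2 x = (x ^ k)⁻¹ := by
  simp [invPowDeriv]

lemma abs_invPowDeriv_le {k : ℕ} (hk : 1 ≤ k) (l : ℕ) {x y : ℝ} (hx : 2 ≤ x)
    (hy : y ∈ Set.Icc (x - 1) (x + 1)) :
    |invPowDeriv k (l + 2) y|
      ≤ (ascPochhammer ℝ l).eval (k : ℝ) * 2 ^ (k + l) * (x ^ (k + l))⁻¹ := by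
  have hy2 : x / 2 ≤ y := by linarith [hy.1]
  have hp : 0 ≤ (ascPochhammer ℝ l).eval (k : ℝ) :=
    (ascPochhammer_pos l (k : ℝ) (by exact_mod_cast hk)).le
  have hy0 : 0 < y := by linarith
  have hx0 : 0 < x := by linarith
  simp only [invPowDeriv, abs_mul, abs_pow, abs_neg, abs_one, one_pow, one_mul, abs_of_nonneg hp,
    abs_inv, abs_of_pos hy0]
  rw [mul_assoc]
  refine mul_le_mul_of_nonneg_left ?_ hp
  rw [← inv_pow, ← inv_pow, ← mul_pow]
  gcongr
  rw [inv_le_comm₀ hy0 (by positivity), mul_inv, inv_inv]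
  linarith

/-- Truncation at order `I` of the asymptotic solution `F` of
`F (x + 1) + F (x - 1) - 2 F x = x⁻ᵏ`. -/
def secondSum (k I : ℕ) (x : ℝ) : ℝ :=
  ∑ i ∈ Finset.range (I + 1), sinhCoeff i * invPowDeriv k (2 * i) x

/-- Inverting the second difference operator `4 sinh² (D / 2)` term by term. -/
lemma abs_second_diff_secondSum_le {k : ℕ} (hk : 1 ≤ k) (I : ℕ) :
    ∃ C : ℝ, 0 ≤ C ∧ ∀ x : ℝ, 2 ≤ x →
      |secondSum k I (x + 1) + secondSum k I (x - 1) - 2 * secondSum k I x - (x ^ k)⁻¹|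
        ≤ C * (x ^ (k + 2 * I + 2))⁻¹ := by
  set Q : ℝ := (ascPochhammer ℝ (2 * I + 2)).eval (k : ℝ) * 2 ^ (k + (2 * I + 2)) with hQ
  have hQ0 : 0 ≤ Q :=
    mul_nonneg (ascPochhammer_pos _ (k : ℝ) (by exact_mod_cast hk)).le (by positivity)
  refine ⟨∑ i ∈ Finset.range (I + 1), |sinhCoeff i| * (2 * Q), by positivity, fun x hx => ?_⟩
  -- the main terms collapse by `sum_sinhCoeff`
  have hmain : ∑ i ∈ Finset.range (I + 1), sinhCoeff i *
      ∑ l ∈ Finset.range (I + 1 - i),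
        invPowDeriv k (2 * i + 2 * (l + 1)) x * (2 / ((2 * (l + 1)).factorial : ℝ))
      = (x ^ k)⁻¹ := by
    have h1 : ∀ j ∈ Finset.range (I + 1), ∑ i ∈ Finset.range (j + 1),
        sinhCoeff i * (invPowDeriv k (2 * i + 2 * (j - i + 1)) x
          * (2 / ((2 * (j - i + 1)).factorial : ℝ)))
        = if j = 0 then (x ^ k)⁻¹ else 0 := by
      intro j _
      calc _ = invPowDeriv k (2 * (j + 1)) x * ∑ i ∈ Finset.range (j + 1),
            sinhCoeff i * (2 / ((2 * (j + 1 - i)).factorial : ℝ)) := by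
            rw [Finset.mul_sum]
            refine Finset.sum_congr rfl fun i hi => ?_
            have hi' : i < j + 1 := Finset.mem_range.mp hi
            rw [show j - i + 1 = j + 1 - i by omega, show 2 * i + 2 * (j + 1 - i) = 2 * (j + 1) by
              omega]
            ring
        _ = _ := by
            rw [sum_sinhCoeff]
            split_ifs with h
            · subst h; simp [invPowDeriv_two]
            · simp
    simp only [Finset.mul_sum]
    rw [← Finset.sum_range_diag_flip (I + 1) (fun i l => sinhCoeff i *
      (invPowDeriv k (2 * i + 2 * (l + 1)) x * (2 / ((2 * (l + 1)).factorial : ℝ)))),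
      Finset.sum_congr rfl h1]
    simp
  rw [← hmain]
  simp only [secondSum]
  rw [Finset.mul_sum, ← Finset.sum_add_distrib, ← Finset.sum_sub_distrib, ← Finset.sum_sub_distrib,
    Finset.sum_mul]
  refine (Finset.abs_sum_le_sum_abs _ _).trans (Finset.sum_le_sum fun i hi => ?_)
  have hi' : i < I + 1 := Finset.mem_range.mp hi
  have h2 := abs_second_diff_le (G := fun l => invPowDeriv k (2 * i + l)) (x := x)
    (B := Q * (x ^ (k + 2 * I + 2))⁻¹) (I + 1 - i) (by linarith)
    (fun l y hy => hasDerivAt_invPowDeriv hk _ hy) (fun y hy => by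
      have := abs_invPowDeriv_le hk (2 * I + 2) hx hy
      rw [show 2 * i + 2 * (I + 1 - i + 1) = 2 * I + 2 + 2 by omega]
      exact this)
  calc _ = |sinhCoeff i| * |invPowDeriv k (2 * i + 0) (x + 1) + invPowDeriv k (2 * i + 0) (x - 1)
        - 2 * invPowDeriv k (2 * i + 0) x - ∑ l ∈ Finset.range (I + 1 - i),
          invPowDeriv k (2 * i + 2 * (l + 1)) x * (2 / ((2 * (l + 1)).factorial : ℝ))| := by
        rw [← abs_mul]
        congr 1
        simp only [add_zero]
        ring
    _ ≤ |sinhCoeff i| * (2 * (Q * (x ^ (k + 2 * I + 2))⁻¹)) := by gcongr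
    _ = _ := by ring

/-! ### First differences, Gamma ratios and telescoping -/

open Filter Topology in
/-- If the derivative tends to `0` at infinity, so does the first difference. -/
lemma tendsto_diff_of_tendsto_deriv {f f' : ℝ → ℝ} (hf : ∀ x, 0 < x → HasDerivAt f (f' x) x)
    (h : Tendsto f' atTop (𝓝 0)) : Tendsto (fun x => f (x + 1) - f x) atTop (𝓝 0) := by
  rw [Metric.tendsto_atTop] at h ⊢
  intro ε hε
  obtain ⟨R, hR⟩ := h (ε / 2) (by positivity)
  refine ⟨max R 1, fun x hx => ?_⟩
  have hx1 : 1 ≤ x := (le_max_right _ _).trans hx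
  have hxR : R ≤ x := (le_max_left _ _).trans hx
  have := (convex_Icc x (x + 1)).norm_image_sub_le_of_norm_hasDerivWithin_le (C := ε / 2)
    (fun y hy => (hf y (by linarith [hy.1])).hasDerivWithinAt)
    (fun y hy => by simpa [dist_eq_norm] using (hR y (hxR.trans hy.1)).le)
    (Set.left_mem_Icc.mpr (by linarith)) (Set.right_mem_Icc.mpr (by linarith))
  rw [dist_zero_right]
  refine this.trans_lt ?_
  simp
  linarith

open Filter Topology in
lemma tendsto_diff_invPowDeriv {k : ℕ} (hk : 1 ≤ k) (l : ℕ) (h : ¬ (k = 1 ∧ l = 0)) :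
    Tendsto (fun x => invPowDeriv k l (x + 1) - invPowDeriv k l x) atTop (𝓝 0) := by
  refine tendsto_diff_of_tendsto_deriv (fun x hx => hasDerivAt_invPowDeriv hk l hx) ?_
  have hinv : ∀ j : ℕ, 1 ≤ j → Tendsto (fun x : ℝ => (x ^ j)⁻¹) atTop (𝓝 0) := fun j hj =>
    (tendsto_pow_atTop (by omega)).inv_tendsto_atTop
  match l with
  | 0 =>
    have hk1 : k ≠ 1 := fun h' => h ⟨h', rfl⟩
    simpa [invPowDeriv, hk1] using ((hinv (k - 1) (by omega)).div_const ((k : ℝ) - 1)).neg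
  | l + 1 =>
    simpa [invPowDeriv] using (hinv (k + l) (by omega)).const_mul
      ((-1) ^ l * (ascPochhammer ℝ l).eval (k : ℝ))

open Filter Topology in
lemma tendsto_diff_invPowDeriv_one_zero :
    Tendsto (fun x => invPowDeriv 1 0 (x + 1) - invPowDeriv 1 0 x - Real.log x) atTop (𝓝 0) := by
  have h1 := Real.tendsto_mul_log_one_add_div_atTop 1
  have h2 := tendsto_diff_invPowDeriv (k := 1) le_rfl 1 (by simp)
  have h3 := (h1.add h2).sub_const 1
  simp only [add_zero, sub_self] at h3
  refine h3.congr' ?_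
  filter_upwards [eventually_gt_atTop 0] with x hx
  have e : Real.log (1 + 1 / x) = Real.log (x + 1) - Real.log x := by
    rw [← Real.log_div (by positivity) (by positivity)]
    congr 1
    field_simp
  rw [e]
  simp [invPowDeriv]
  ring

open Filter Topology in
lemma tendsto_diff_secondSum {k : ℕ} (hk : 1 ≤ k) (I : ℕ) :
    Tendsto (fun x => secondSum k I (x + 1) - secondSum k I x - if k = 1 then Real.log x else 0)
      atTop (𝓝 0) := by
  have h0 : Tendsto (fun x => invPowDeriv k 0 (x + 1) - invPowDeriv k 0 x
      - if k = 1 then Real.log x else 0) atTop (𝓝 0) := by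
    split_ifs with h
    · subst h; exact tendsto_diff_invPowDeriv_one_zero
    · simpa using tendsto_diff_invPowDeriv hk 0 (by simp [h])
  have h1 : Tendsto (fun x => ∑ i ∈ Finset.range I, sinhCoeff (i + 1) *
      (invPowDeriv k (2 * (i + 1)) (x + 1) - invPowDeriv k (2 * (i + 1)) x)) atTop (𝓝 0) := by
    rw [show (0 : ℝ) = ∑ i ∈ Finset.range I, sinhCoeff (i + 1) * 0 by simp]
    exact tendsto_finsetSum _ fun i _ =>
      (tendsto_diff_invPowDeriv hk _ (by omega)).const_mul _
  have h2 := h1.add h0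
  rw [add_zero] at h2
  refine h2.congr fun x => ?_
  have e0 : sinhCoeff 0 = 1 := by simp [sinhCoeff]
  simp only [secondSum, Finset.sum_range_succ', mul_zero, e0, one_mul, mul_sub,
    Finset.sum_sub_distrib]
  ring

/-- Truncation of the asymptotic solution `F` of `F (x + 1) + F (x - 1) - 2 F x = log (1 - s / x)`.
When `s ~ 1 / n` and `x ~ n`, it keeps the terms of order up to `n ^ (-2N)`. -/
def gammaSum (N : ℕ) (s x : ℝ) : ℝ :=
  -∑ k ∈ Finset.range (N + 1), s ^ (k + 1) / ((k : ℝ) + 1) * secondSum (k + 1) (N - k) x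

open Filter Topology in
lemma tendsto_diff_gammaSum (N : ℕ) (s : ℝ) :
    Tendsto (fun x => gammaSum N s (x + 1) - gammaSum N s x + s * Real.log x) atTop (𝓝 0) := by
  have h1 : Tendsto (fun x => -∑ k ∈ Finset.range (N + 1), s ^ (k + 1) / ((k : ℝ) + 1) *
      (secondSum (k + 1) (N - k) (x + 1) - secondSum (k + 1) (N - k) x
        - if k + 1 = 1 then Real.log x else 0)) atTop (𝓝 0) := by
    have h2 : ∀ k ∈ Finset.range (N + 1), Tendsto (fun x => s ^ (k + 1) / ((k : ℝ) + 1) *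
        (secondSum (k + 1) (N - k) (x + 1) - secondSum (k + 1) (N - k) x
          - if k + 1 = 1 then Real.log x else 0)) atTop (𝓝 (s ^ (k + 1) / ((k : ℝ) + 1) * 0)) :=
      fun k _ => (tendsto_diff_secondSum (Nat.succ_pos k) (N - k)).const_mul _
    simpa only [mul_zero, Finset.sum_const_zero, neg_zero] using (tendsto_finsetSum _ h2).neg
  refine h1.congr fun x => ?_
  simp only [gammaSum, mul_sub, Finset.sum_sub_distrib, add_eq_right, mul_ite, mul_zero,
    Finset.sum_ite_eq', Finset.mem_range]
  simp
  ring

open Filter Topology Real.BohrMollerup in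
/-- `Γ (X + 1 - s) / Γ (X + 1) ~ X ^ (-s)`. -/
lemma tendsto_log_Gamma_ratio {s : ℝ} (hs : s < 1) :
    Tendsto (fun X : ℕ => Real.log (Real.Gamma (X + 1 - s)) - Real.log (Real.Gamma (X + 1))
      + s * Real.log X) atTop (𝓝 0) := by
  have h1 := tendsto_log_gamma (x := 1 - s) (by linarith)
  have h2 : Tendsto (fun X : ℕ => Real.log X - Real.log (X + 1 - s)) atTop (𝓝 0) := by
    have h3 : Tendsto (fun X : ℕ => Real.log (1 + (1 - s) / X)) atTop (𝓝 (Real.log 1)) := by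
      refine (Real.continuousAt_log one_ne_zero).tendsto.comp ?_
      have := (tendsto_const_div_atTop_nhds_zero_nat (1 - s)).const_add 1
      simpa using this
    rw [Real.log_one] at h3
    have h4 := h3.neg
    rw [neg_zero] at h4
    refine h4.congr' ?_
    filter_upwards [eventually_gt_atTop 0] with X hX
    have hX' : (0 : ℝ) < X := by exact_mod_cast hX
    rw [← Real.log_div (by positivity) (by linarith), ← Real.log_inv]
    congr 1
    rw [inv_eq_iff_eq_inv, inv_div]
    field_simp
    ring
  have h3 := ((tendsto_const_nhds (x := Real.log (Real.Gamma (1 - s)))).sub h1).add h2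
  rw [sub_self, zero_add] at h3
  refine h3.congr fun X => ?_
  have h4 := f_add_nat_eq (f := Real.log ∘ Real.Gamma) (x := 1 - s) (fun {y} hy => by
    simp only [Function.comp_apply]
    rw [Real.Gamma_add_one hy.ne', Real.log_mul hy.ne' (Real.Gamma_pos_of_pos hy).ne', add_comm])
    (by linarith) X
  simp only [Function.comp_apply] at h4
  rw [show (X : ℝ) + 1 - s = 1 - s + X by ring, h4, Real.Gamma_nat_eq_factorial, logGammaSeq,
    Finset.sum_range_succ]
  ring

/-- A null sequence whose increments are `O(1 / x²)` is `O(1 / x)`, with the same constant. -/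
lemma abs_le_div_of_increment {d : ℕ → ℝ} {E : ℝ} (hE : 0 ≤ E) {x₀ : ℕ} (h0 : 1 ≤ x₀)
    (hd : ∀ x, x₀ ≤ x → |d (x + 1) - d x| ≤ E / ((x : ℝ) + 1) ^ 2)
    (hlim : Filter.Tendsto d Filter.atTop (nhds 0)) {x : ℕ} (hx : x₀ ≤ x) : |d x| ≤ E / x := by
  have hstep : ∀ y : ℕ, x₀ ≤ y → |d (y + 1) - d y| ≤ E / y - E / ((y + 1 : ℕ) : ℝ) := by
    intro y hy
    refine (hd y hy).trans ?_
    have hy0 : (0 : ℝ) < y := by exact_mod_cast (by omega : 0 < y)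
    push_cast
    rw [div_sub_div _ _ hy0.ne' (by positivity), div_le_div_iff₀ (by positivity) (by positivity)]
    nlinarith [mul_nonneg hE hy0.le, mul_nonneg hE (mul_nonneg hy0.le hy0.le)]
  have hE0 : Filter.Tendsto (fun j : ℕ => E / ((x + j : ℕ) : ℝ)) Filter.atTop (nhds 0) :=
    (tendsto_const_div_atTop_nhds_zero_nat E).comp (Filter.tendsto_add_atTop_iff_nat x |>.mpr
      Filter.tendsto_id |>.congr fun j => by simp [add_comm])
  have hd0 : Filter.Tendsto (fun j : ℕ => d (x + j)) Filter.atTop (nhds 0) := by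
    have := (Filter.tendsto_add_atTop_iff_nat x).mpr hlim
    exact this.congr fun j => by rw [add_comm]
  have hm1 : Monotone (fun j : ℕ => d (x + j) - E / ((x + j : ℕ) : ℝ)) := by
    refine monotone_nat_of_le_succ fun j => ?_
    have := (abs_le.mp (hstep (x + j) (by omega))).1
    rw [show x + (j + 1) = x + j + 1 by ring]
    linarith
  have hm2 : Monotone (fun j : ℕ => -d (x + j) - E / ((x + j : ℕ) : ℝ)) := by
    refine monotone_nat_of_le_succ fun j => ?_
    have := (abs_le.mp (hstep (x + j) (by omega))).2
    rw [show x + (j + 1) = x + j + 1 by ring]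
    linarith
  have l1 := hm1.ge_of_tendsto (by simpa using hd0.sub hE0) 0
  have l2 := hm2.ge_of_tendsto (by simpa using hd0.neg.sub hE0) 0
  simp only [add_zero] at l1 l2
  rw [abs_le]
  constructor <;> linarith

/-! ### Products of Gamma ratios -/

lemma pow_mul_inv_pow_le {P δ n s y : ℝ} (hδ : 0 < δ) (hn : 0 < n) (hs : 0 ≤ s)
    (hsn : s ≤ P / n) (hy : δ * n ≤ y) (a b : ℕ) :
    s ^ a * (y ^ (b + 2))⁻¹ ≤ P ^ a * (δ ^ b)⁻¹ * (n ^ (a + b))⁻¹ * (y ^ 2)⁻¹ := by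
  have hδn : 0 < δ * n := by positivity
  have hy0 : 0 < y := hδn.trans_le hy
  have hPn := pow_nonneg (hs.trans hsn) a
  calc s ^ a * (y ^ (b + 2))⁻¹ = s ^ a * (y ^ b)⁻¹ * (y ^ 2)⁻¹ := by
        rw [pow_add, mul_inv]; ring
    _ ≤ (P / n) ^ a * ((δ * n) ^ b)⁻¹ * (y ^ 2)⁻¹ := by gcongr
    _ = _ := by rw [div_pow, mul_pow, mul_inv, pow_add, mul_inv]; field_simp

/-- For `s = O(1 / n)` and `y ≥ δ n`, `gammaSum` solves the second difference equation of
`log (1 - s / y)` up to `O(n⁻²ᴺ⁻² y⁻²)`. -/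
lemma abs_second_diff_gammaSum_le (N : ℕ) {P δ : ℝ} (hP : 0 ≤ P) (hδ : 0 < δ) :
    ∃ E : ℝ, 0 ≤ E ∧ ∀ n s y : ℝ, 0 < n → 0 ≤ s → s ≤ P / n → δ * n ≤ y → 2 ≤ y → s ≤ y / 2 →
      |Real.log (1 - s / y)
        - (gammaSum N s (y + 1) + gammaSum N s (y - 1) - 2 * gammaSum N s y)|
        ≤ E / n ^ (2 * N + 2) / y ^ 2 := by
  choose C hC0 hC using fun k : ℕ => abs_second_diff_secondSum_le (Nat.succ_pos k) (N - k)
  refine ⟨2 * (P ^ (N + 2) * (δ ^ N)⁻¹) + ∑ k ∈ Finset.range (N + 1),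
      C k * (P ^ (k + 1) * (δ ^ (2 * N + 1 - k))⁻¹), ?_, ?_⟩
  · have : ∀ k, 0 ≤ C k := hC0
    exact add_nonneg (by positivity) (Finset.sum_nonneg fun k _ => mul_nonneg (this k)
      (by positivity))
  intro n s y hn hs hsn hy hy2 hsy
  have hy0 : 0 < y := by linarith
  have hu0 : 0 ≤ s / y := by positivity
  have hu : s / y ≤ 1 / 2 := by rw [div_le_iff₀ hy0]; linarith
  have h1 := Real.abs_log_sub_add_sum_range_le (x := s / y) (by rw [abs_of_nonneg hu0]; linarith)
    (N + 1)
  rw [abs_of_nonneg hu0] at h1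
  have h1' : (s / y) ^ (N + 1 + 1) / (1 - s / y)
      ≤ 2 * (P ^ (N + 2) * (δ ^ N)⁻¹) * (n ^ (2 * N + 2))⁻¹ * (y ^ 2)⁻¹ := by
    calc (s / y) ^ (N + 1 + 1) / (1 - s / y) ≤ (s / y) ^ (N + 2) / (1 / 2) := by
          gcongr
          linarith
      _ = 2 * (s ^ (N + 2) * (y ^ (N + 2))⁻¹) := by rw [div_pow]; ring
      _ ≤ 2 * (P ^ (N + 2) * (δ ^ N)⁻¹ * (n ^ (N + 2 + N))⁻¹ * (y ^ 2)⁻¹) := by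
          gcongr 2 * ?_
          exact pow_mul_inv_pow_le hδ hn hs hsn hy _ _
      _ = _ := by rw [show N + 2 + N = 2 * N + 2 by ring]; ring
  have h2 : |∑ k ∈ Finset.range (N + 1), s ^ (k + 1) / ((k : ℝ) + 1) *
      (secondSum (k + 1) (N - k) (y + 1) + secondSum (k + 1) (N - k) (y - 1)
        - 2 * secondSum (k + 1) (N - k) y - (y ^ (k + 1))⁻¹)|
      ≤ (∑ k ∈ Finset.range (N + 1), C k * (P ^ (k + 1) * (δ ^ (2 * N + 1 - k))⁻¹))
        * (n ^ (2 * N + 2))⁻¹ * (y ^ 2)⁻¹ := by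
    rw [Finset.sum_mul, Finset.sum_mul]
    refine (Finset.abs_sum_le_sum_abs _ _).trans (Finset.sum_le_sum fun k hk => ?_)
    have hk' : k < N + 1 := Finset.mem_range.mp hk
    have hb := hC k y hy2
    rw [show k.succ + 2 * (N - k) + 2 = (2 * N + 1 - k) + 2 by omega] at hb
    rw [abs_mul, abs_of_nonneg (by positivity)]
    have hk1 : s ^ (k + 1) / ((k : ℝ) + 1) ≤ s ^ (k + 1) := by
      apply div_le_self (by positivity)
      linarith [(Nat.cast_nonneg k : (0 : ℝ) ≤ k)]
    calc _ ≤ s ^ (k + 1) * (C k * (y ^ (2 * N + 1 - k + 2))⁻¹) := by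
          refine mul_le_mul hk1 hb (abs_nonneg _) (by positivity)
      _ = C k * (s ^ (k + 1) * (y ^ (2 * N + 1 - k + 2))⁻¹) := by ring
      _ ≤ C k * (P ^ (k + 1) * (δ ^ (2 * N + 1 - k))⁻¹ * (n ^ (k + 1 + (2 * N + 1 - k)))⁻¹
            * (y ^ 2)⁻¹) := by
          refine mul_le_mul_of_nonneg_left ?_ (hC0 k)
          exact pow_mul_inv_pow_le hδ hn hs hsn hy _ _
      _ = _ := by rw [show k + 1 + (2 * N + 1 - k) = 2 * N + 2 by omega]; ring
  have h3 : Real.log (1 - s / y)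
        - (gammaSum N s (y + 1) + gammaSum N s (y - 1) - 2 * gammaSum N s y)
      = (∑ i ∈ Finset.range (N + 1), (s / y) ^ (i + 1) / ((i : ℝ) + 1) + Real.log (1 - s / y))
        + ∑ k ∈ Finset.range (N + 1), s ^ (k + 1) / ((k : ℝ) + 1) *
      (secondSum (k + 1) (N - k) (y + 1) + secondSum (k + 1) (N - k) (y - 1)
        - 2 * secondSum (k + 1) (N - k) y - (y ^ (k + 1))⁻¹) := by
    simp only [gammaSum, mul_sub, mul_add, Finset.sum_sub_distrib, Finset.sum_add_distrib, div_pow]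
    have e1 : ∀ i : ℕ, s ^ (i + 1) / y ^ (i + 1) / ((i : ℝ) + 1)
        = s ^ (i + 1) / ((i : ℝ) + 1) * (y ^ (i + 1))⁻¹ := fun i => by ring
    have e2 : ∀ i : ℕ, s ^ (i + 1) / ((i : ℝ) + 1) * (2 * secondSum (i + 1) (N - i) y)
        = 2 * (s ^ (i + 1) / ((i : ℝ) + 1) * secondSum (i + 1) (N - i) y) := fun i => by ring
    simp only [e1, e2, ← Finset.mul_sum]
    ring
  rw [h3]
  refine (abs_add_le _ _).trans ((add_le_add (h1.trans h1') h2).trans (le_of_eq ?_))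
  simp only [div_eq_mul_inv]
  ring

lemma log_Gamma_add_one {x : ℝ} (hx : 0 < x) :
    Real.log (Real.Gamma (x + 1)) = Real.log x + Real.log (Real.Gamma x) := by
  rw [Real.Gamma_add_one hx.ne', Real.log_mul hx.ne' (Real.Gamma_pos_of_pos hx).ne']

/-- The first difference of `gammaSum` approximates `log (Γ (x + 1 - s) / Γ (x + 1))`. -/
lemma abs_log_Gamma_sub_diff_gammaSum_le (N : ℕ) {P δ : ℝ} (hP : 0 ≤ P) (hδ : 0 < δ) :
    ∃ E : ℝ, 0 ≤ E ∧ ∀ (n s : ℝ) (x : ℕ), 0 < n → 0 ≤ s → s < 1 → s ≤ P / n → δ * n ≤ x →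
      2 ≤ x → |Real.log (Real.Gamma (x + 1 - s)) - Real.log (Real.Gamma (x + 1))
        - (gammaSum N s (x + 1) - gammaSum N s x)| ≤ E / n ^ (2 * N + 2) / x := by
  obtain ⟨E, hE0, hE⟩ := abs_second_diff_gammaSum_le N hP hδ
  refine ⟨E, hE0, fun n s x hn hs hs1 hsn hx hx2 => ?_⟩
  refine abs_le_div_of_increment (d := fun x : ℕ => Real.log (Real.Gamma (x + 1 - s))
    - Real.log (Real.Gamma (x + 1)) - (gammaSum N s (x + 1) - gammaSum N s x)) (x₀ := x)
    (by positivity) (by omega) (fun y hy => ?_) ?_ le_rfl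
  · have hyx : (x : ℝ) ≤ y := by exact_mod_cast hy
    have hx2' : (2 : ℝ) ≤ x := by exact_mod_cast hx2
    have h := hE n s (y + 1) hn hs hsn (by linarith) (by linarith) (by linarith)
    convert h using 2
    have e1 := log_Gamma_add_one (x := (y : ℝ) + 1 - s) (by linarith)
    have e2 := log_Gamma_add_one (x := (y : ℝ) + 1) (by linarith)
    have e3 : Real.log (1 - s / ((y : ℝ) + 1))
        = Real.log ((y : ℝ) + 1 - s) - Real.log ((y : ℝ) + 1) := by
      rw [← Real.log_div (by linarith) (by linarith)]
      congr 1
      field_simp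
    push_cast
    rw [show (y : ℝ) + 1 + 1 - s = (y : ℝ) + 1 - s + 1 by ring, e1, e2, e3,
      show (y : ℝ) + 1 - 1 = y by ring]
    ring
  · have h1 := (tendsto_log_Gamma_ratio hs1).sub
      ((tendsto_diff_gammaSum N s).comp tendsto_natCast_atTop_atTop)
    rw [sub_zero] at h1
    refine h1.congr fun y => ?_
    simp only [Function.comp_apply]
    ring

/-- The product of Gamma ratios `∏ Γ (x + 1 - s) / Γ (x + 1)`, `r ≤ x < r + n`, through
`gammaSum`. -/
lemma abs_sum_log_Gamma_sub_gammaSum_le (N : ℕ) {P δ : ℝ} (hP : 0 ≤ P) (hδ : 0 < δ) :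
    ∃ E : ℝ, 0 ≤ E ∧ ∀ (n r : ℕ) (s : ℝ), 0 < n → 0 ≤ s → s < 1 → s ≤ P / n → δ * n ≤ r →
      2 ≤ r → |∑ i ∈ Finset.range n, (Real.log (Real.Gamma ((r + i : ℕ) + 1 - s))
          - Real.log (Real.Gamma ((r + i : ℕ) + 1)))
        - (gammaSum N s (r + n : ℕ) - gammaSum N s r)| ≤ E / n ^ (2 * N + 2) := by
  obtain ⟨E, hE0, hE⟩ := abs_log_Gamma_sub_diff_gammaSum_le N hP hδ
  refine ⟨E / δ, by positivity, fun n r s hn hs hs1 hsn hr hr2 => ?_⟩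
  have hn' : (0 : ℝ) < n := by exact_mod_cast hn
  have ht : gammaSum N s (r + n : ℕ) - gammaSum N s r = ∑ i ∈ Finset.range n,
      (gammaSum N s ((r + i : ℕ) + 1) - gammaSum N s (r + i : ℕ)) := by
    have := Finset.sum_range_sub (fun i => gammaSum N s ((r + i : ℕ) : ℝ)) n
    rw [add_zero] at this
    rw [← this]
    refine Finset.sum_congr rfl fun i _ => ?_
    push_cast
    ring_nf
  rw [ht, ← Finset.sum_sub_distrib]
  refine (Finset.abs_sum_le_sum_abs _ _).trans ?_
  calc _ ≤ ∑ i ∈ Finset.range n, E / (n : ℝ) ^ (2 * N + 2) / (δ * n) := by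
        refine Finset.sum_le_sum fun i _ => ?_
        have hri : (r : ℝ) ≤ (r + i : ℕ) := by exact_mod_cast Nat.le_add_right r i
        refine (hE n s (r + i) hn' hs hs1 hsn (hr.trans hri) (by omega)).trans ?_
        gcongr
        exact hr.trans hri
    _ = _ := by
        rw [Finset.sum_const, Finset.card_range, nsmul_eq_mul]
        field_simp

/-! ### Identification of the coefficients -/

/-- The terms of `gammaSum` of total order `2q` in `1 / n`, when `s ~ 1 / n` and `x ~ n`. -/
def gammaTerm (q : ℕ) (s x : ℝ) : ℝ :=
  ∑ k ∈ Finset.range (q + 1),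
    s ^ (k + 1) / ((k : ℝ) + 1) * (sinhCoeff (q - k) * invPowDeriv (k + 1) (2 * (q - k)) x)

lemma gammaSum_eq_sum_gammaTerm (N : ℕ) (s x : ℝ) :
    gammaSum N s x = -∑ q ∈ Finset.range (N + 1), gammaTerm q s x := by
  simp only [gammaSum, secondSum, gammaTerm, Finset.mul_sum]
  rw [Finset.sum_range_diag_flip (N + 1) (fun k i => s ^ (k + 1) / ((k : ℝ) + 1) *
    (sinhCoeff i * invPowDeriv (k + 1) (2 * i) x))]
  congr 1
  refine Finset.sum_congr rfl fun k hk => ?_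
  rw [show N - k + 1 = N + 1 - k by have := Finset.mem_range.mp hk; omega]

lemma ascPochhammer_eval_succ_eq (b l : ℕ) :
    (ascPochhammer ℝ l).eval ((b : ℝ) + 1) = ((b + l).factorial : ℝ) / (b.factorial : ℝ) := by
  rw [eq_div_iff (by positivity), mul_comm, ← Nat.factorial_mul_ascFactorial]
  push_cast
  rw [← ascPochhammer_nat_eq_ascFactorial, ascPochhammer_eval_cast]
  push_cast
  rfl

lemma genHarmonic_neg (p q : ℕ) :
    genHarmonic p (-(q : ℤ)) = ∑ k ∈ Finset.Icc 1 p, (k : ℝ) ^ q := by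
  simp [genHarmonic]

/-- The contributions to `coeffA` of the Bernoulli numbers beyond `B₂`. -/
lemma gammaTerm_bernoulli {n c : ℝ} (p : ℕ) (hn : 0 < n) (hc0 : c ≠ 0) (hc1 : c < 1) {q j : ℕ}
    (hj : 1 ≤ j) (hjq : j < q) :
    ((p : ℝ) / n) ^ (q - j) / ((q : ℝ) - j) *
        (sinhCoeff (j + 1) * invPowDeriv (q - j) (2 * (j + 1)) (n / c))
      - ((p : ℝ) / n) ^ (q - j) / ((q : ℝ) - j) *
        (sinhCoeff (j + 1) * invPowDeriv (q - j) (2 * (j + 1)) (n * (1 - c) / c))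
    = -((bernoulli (2 * j + 2) : ℝ) * c ^ (2 * j)
              * (ascPochhammer ℝ (q - j)).eval (2 * (j : ℝ)) * (p * c) ^ (q - j)
            / (4 * j * (j + 1) * ((q - j).factorial : ℝ))
            * (1 - ((1 - c) ^ (j + q))⁻¹)) / n ^ (2 * q) := by
  obtain ⟨a, rfl⟩ := Nat.exists_eq_add_of_lt hjq
  obtain ⟨j, rfl⟩ := Nat.exists_eq_add_of_le' hj
  have e1 : j + 1 + a + 1 - (j + 1) = a + 1 := by omega
  have e2 : 2 * (j + 1 + 1) = 2 * (j + 1) + 2 := by ring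
  have hc1' : 0 < 1 - c := by linarith
  simp only [e1, e2, invPowDeriv, sinhCoeff]
  rw [show (2 : ℝ) * ((j + 1 : ℕ) : ℝ) = ((2 * j + 1 : ℕ) : ℝ) + 1 by push_cast; ring,
    ascPochhammer_eval_succ_eq]
  push_cast
  rw [ascPochhammer_eval_succ_eq, show a + 2 * (j + 1) = 2 * j + 1 + (a + 1) by ring,
    show 2 * (j + 1) + 2 = 2 * j + 1 + 1 + 1 + 1 by ring, Nat.factorial_succ (2 * j + 1 + 1 + 1),
    Nat.factorial_succ (2 * j + 1 + 1), Nat.factorial_succ (2 * j + 1), Nat.factorial_succ a]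
  have e4 : Even (2 * (j + 1)) := even_two_mul _
  rw [e4.neg_one_pow]
  set F : ℝ := ((2 * j + 1 + (a + 1)).factorial : ℝ)
  set B : ℝ := (bernoulli (2 * j + 1 + 1 + 1 + 1) : ℝ) with hB
  have hf1 : ((2 * j + 1).factorial : ℝ) ≠ 0 := by positivity
  have hf2 : (a.factorial : ℝ) ≠ 0 := by positivity
  have hne : (1 - c) ≠ 0 := hc1'.ne'
  have e5 : (j : ℝ) + 1 + a + 1 - (j + 1) = a + 1 := by ring
  rw [e5]
  simp only [div_pow, mul_pow, inv_div]
  push_cast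
  field_simp
  ring

lemma sinhCoeff_zero : sinhCoeff 0 = 1 := by simp [sinhCoeff]

lemma sinhCoeff_one : sinhCoeff 1 = -1 / 12 := by
  norm_num [sinhCoeff, bernoulli_two]

lemma gammaTerm_sub_of_two_le {n c : ℝ} (p : ℕ) (hn : 0 < n) (hc0 : 0 < c) (hc1 : c < 1) {q : ℕ}
    (hq : 2 ≤ q) :
    gammaTerm q (p / n) (n / c) - gammaTerm q (p / n) (n * (1 - c) / c)
        + ∑ k ∈ Finset.Icc 1 p, ((k : ℝ) * c / n ^ 2) ^ q / q
      = -(coeffA p c q / n ^ (2 * q)) := by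
  have hc1' : 0 < 1 - c := by linarith
  have hq2 : (2 : ℝ) ≤ q := by exact_mod_cast hq
  have hsum : (∑ k ∈ Finset.range (q - 1), ((p : ℝ) / n) ^ (k + 1) / ((k : ℝ) + 1) *
        (sinhCoeff (q - k) * invPowDeriv (k + 1) (2 * (q - k)) (n / c)))
      - (∑ k ∈ Finset.range (q - 1), ((p : ℝ) / n) ^ (k + 1) / ((k : ℝ) + 1) *
        (sinhCoeff (q - k) * invPowDeriv (k + 1) (2 * (q - k)) (n * (1 - c) / c)))
      = -(∑ j ∈ Finset.Icc 1 (q - 1),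
          (bernoulli (2 * j + 2) : ℝ) * c ^ (2 * j)
              * (ascPochhammer ℝ (q - j)).eval (2 * (j : ℝ)) * (p * c) ^ (q - j)
            / (4 * j * (j + 1) * ((q - j).factorial : ℝ))
            * (1 - ((1 - c) ^ (j + q))⁻¹)) / n ^ (2 * q) := by
    rw [← Finset.sum_sub_distrib, ← Finset.sum_neg_distrib, Finset.sum_div]
    refine Finset.sum_nbij' (fun k => q - 1 - k) (fun j => q - 1 - j) ?_ ?_ ?_ ?_ ?_
    · intro k hk; rw [Finset.mem_range] at hk; rw [Finset.mem_Icc]; omega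
    · intro k hk; rw [Finset.mem_Icc] at hk; rw [Finset.mem_range]; omega
    · intro k hk; rw [Finset.mem_range] at hk; omega
    · intro k hk; rw [Finset.mem_Icc] at hk; omega
    · intro k hk
      rw [Finset.mem_range] at hk
      rw [← gammaTerm_bernoulli p hn hc0.ne' hc1 (j := q - 1 - k) (by omega) (by omega),
        show q - (q - 1 - k) = k + 1 by omega, show q - 1 - k + 1 = q - k by omega,
        show (q : ℝ) - ((q - 1 - k : ℕ) : ℝ) = (k : ℝ) + 1 by
          rw [Nat.cast_sub (by omega), Nat.cast_sub (by omega)]; push_cast; ring]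
  have hpow : ∑ k ∈ Finset.Icc 1 p, ((k : ℝ) * c / n ^ 2) ^ q / q
      = c ^ q / q * genHarmonic p (-(q : ℤ)) / n ^ (2 * q) := by
    rw [genHarmonic_neg, Finset.mul_sum, Finset.sum_div]
    refine Finset.sum_congr rfl fun k _ => ?_
    rw [div_pow, mul_pow, ← pow_mul]
    ring
  have hsplit : ∀ x, gammaTerm q (p / n) x
      = (∑ k ∈ Finset.range (q - 1), ((p : ℝ) / n) ^ (k + 1) / ((k : ℝ) + 1) *
          (sinhCoeff (q - k) * invPowDeriv (k + 1) (2 * (q - k)) x))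
        + ((p : ℝ) / n) ^ q / q * (-1 / 12 * (x ^ q)⁻¹)
        + ((p : ℝ) / n) ^ (q + 1) / (q + 1) * ((x ^ (q - 1))⁻¹ / (q * (q - 1))) := by
    intro x
    obtain ⟨r, rfl⟩ := Nat.exists_eq_add_of_le' hq
    have e1 : r + 2 - (r + 1) = 1 := by omega
    rw [gammaTerm, Finset.sum_range_succ, Finset.sum_range_succ]
    simp only [e1, Nat.sub_self, sinhCoeff_zero, sinhCoeff_one, mul_zero, mul_one, one_mul,
      show r + 2 - 1 = r + 1 from rfl]
    rw [show r + 1 + 1 = r + 2 from rfl, invPowDeriv_two]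
    have e2 : r + 2 + 1 ≠ 1 := by omega
    have e3 : r + 2 + 1 ≠ 2 := by omega
    simp only [invPowDeriv, if_neg e2, if_neg e3]
    push_cast
    rw [show (r : ℝ) + 1 + 1 = r + 2 by ring, show (r : ℝ) + 2 + 1 - 1 = r + 2 by ring,
      show (r : ℝ) + 2 + 1 - 2 = r + 2 - 1 by ring]
  have hq0 : q ≠ 0 := by omega
  have hq1 : q ≠ 1 := by omega
  rw [coeffA, if_neg hq0, if_neg hq1, hpow, hsplit, hsplit]
  have hmain : ((p : ℝ) / n) ^ q / q * (-1 / 12 * ((n / c) ^ q)⁻¹)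
        + ((p : ℝ) / n) ^ (q + 1) / (q + 1) * (((n / c) ^ (q - 1))⁻¹ / (q * (q - 1)))
      - (((p : ℝ) / n) ^ q / q * (-1 / 12 * ((n * (1 - c) / c) ^ q)⁻¹)
        + ((p : ℝ) / n) ^ (q + 1) / (q + 1)
          * (((n * (1 - c) / c) ^ (q - 1))⁻¹ / (q * (q - 1))))
      = -((c * p) ^ q * (c + 12 * p - 12 * c * p - c * (q : ℝ) ^ 2)
        / (12 * c * q * (-1 + (q : ℝ) ^ 2) * (1 - c) ^ q)
      + (c * p) ^ q * (-12 * p + c * (-1 + (q : ℝ) ^ 2)) / (12 * c * q * (-1 + (q : ℝ) ^ 2)))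
        / n ^ (2 * q) := by
    obtain ⟨r, rfl⟩ := Nat.exists_eq_add_of_le' hq
    rw [show r + 2 - 1 = r + 1 from rfl]
    have h1 : ((r + 2 : ℕ) : ℝ) - 1 ≠ 0 := by linarith
    have h2 : ((r + 2 : ℕ) : ℝ) + 1 ≠ 0 := by linarith
    have h3 : ((r + 2 : ℕ) : ℝ) ≠ 0 := by linarith
    rw [show -1 + ((r + 2 : ℕ) : ℝ) ^ 2 = (((r + 2 : ℕ) : ℝ) - 1) * (((r + 2 : ℕ) : ℝ) + 1) by ring]
    have h4 : 1 - c ≠ 0 := hc1'.ne'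
    generalize ((r + 2 : ℕ) : ℝ) = Q at *
    generalize hu : 1 - c = u at *
    obtain rfl : c = 1 - u := by linarith
    simp only [div_pow, mul_pow]
    field_simp
    ring
  linear_combination hsum + hmain

lemma gammaTerm_sub_zero {n c : ℝ} (p : ℕ) (hn : 0 < n) (hc0 : 0 < c) (hc1 : c < 1) :
    gammaTerm 0 (p / n) (n / c) - gammaTerm 0 (p / n) (n * (1 - c) / c) - p * Real.log (n / c)
      = -(coeffA p c 0 / n ^ (2 * 0)) := by
  have hc1' : 0 < 1 - c := by linarith
  have e : n * (1 - c) / c = n / c * (1 - c) := by ring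
  rw [e, gammaTerm, gammaTerm]
  simp only [coeffA, invPowDeriv, sinhCoeff_zero, zero_add, Finset.sum_range_one, if_true,
    mul_zero, pow_zero, Nat.sub_self]
  rw [Real.log_mul (by positivity) hc1'.ne']
  generalize Real.log (n / c) = L
  push_cast
  field_simp
  ring

lemma gammaTerm_sub_one {n c : ℝ} (p : ℕ) (hn : 0 < n) (hc0 : 0 < c) (hc1 : c < 1) :
    gammaTerm 1 (p / n) (n / c) - gammaTerm 1 (p / n) (n * (1 - c) / c)
        + ∑ k ∈ Finset.Icc 1 p, ((k : ℝ) * c / n ^ 2) ^ 1 / (1 : ℕ)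
      = -(coeffA p c 1 / n ^ (2 * 1)) := by
  have hc1' : 0 < 1 - c := by linarith
  have hc2 : c - 1 ≠ 0 := by linarith
  have hk : ∑ k ∈ Finset.Icc 1 p, (k : ℝ) = p * (p + 1) / 2 := by
    induction p with
    | zero => simp
    | succ p ih => rw [Finset.sum_Icc_succ_top (by omega), ih]; push_cast; ring
  have hs : ∑ k ∈ Finset.Icc 1 p, ((k : ℝ) * c / n ^ 2) ^ 1 / (1 : ℕ)
      = p * (p + 1) / 2 * c / n ^ 2 := by
    rw [← hk, Finset.sum_mul, Finset.sum_div]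
    exact Finset.sum_congr rfl fun k _ => by simp
  have e : n * (1 - c) / c = n / c * (1 - c) := by ring
  have hT : ∀ s x, gammaTerm 1 s x = s * (-1 / 12 * x⁻¹) + s ^ 2 / 2 * -Real.log x := by
    intro s x
    rw [gammaTerm, Finset.sum_range_succ, Finset.sum_range_one]
    norm_num [sinhCoeff_zero, sinhCoeff_one, invPowDeriv]
  rw [hs, e, hT, hT, Real.log_mul (by positivity) hc1'.ne']
  simp only [coeffA, one_ne_zero, if_false, if_true]
  generalize Real.log (n / c) = L
  generalize Real.log (1 - c) = K
  generalize hu : 1 - c = u at *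
  obtain rfl : c = 1 - u := by linarith
  have hu1 : (1 : ℝ) - u - 1 = -u := by ring
  rw [hu1]
  field_simp
  ring

/-- The terms of `gammaSum` of total order `2q`, together with those of
`∑ k, log (1 - k c / n²)`, sum to `coeffA p c q / n ^ (2 * q)`. -/
lemma sum_coeffA_eq (N : ℕ) {n c : ℝ} (p : ℕ) (hn : 0 < n) (hc0 : 0 < c) (hc1 : c < 1) :
    p * Real.log (n / c)
      + (gammaSum N (p / n) (n / c) - gammaSum N (p / n) (n * (1 - c) / c))
      - ∑ k ∈ Finset.Icc 1 p, ∑ q ∈ Finset.range N,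
          ((k : ℝ) * c / n ^ 2) ^ (q + 1) / ((q : ℝ) + 1)
      = ∑ q ∈ Finset.range (N + 1), coeffA p c q / n ^ (2 * q) := by
  have h : ∀ q, gammaTerm (q + 1) (p / n) (n / c) - gammaTerm (q + 1) (p / n) (n * (1 - c) / c)
        + ∑ k ∈ Finset.Icc 1 p, ((k : ℝ) * c / n ^ 2) ^ (q + 1) / ((q : ℝ) + 1)
      = -(coeffA p c (q + 1) / n ^ (2 * (q + 1))) := by
    intro q
    rcases Nat.eq_zero_or_pos q with rfl | hq
    · simpa using gammaTerm_sub_one p hn hc0 hc1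
    · simpa using gammaTerm_sub_of_two_le p hn hc0 hc1 (q := q + 1) (by omega)
  have h0 := gammaTerm_sub_zero p hn hc0 hc1
  have hs := Finset.sum_congr (rfl : Finset.range N = Finset.range N) fun q _ => h q
  rw [Finset.sum_add_distrib, Finset.sum_sub_distrib, Finset.sum_neg_distrib] at hs
  rw [gammaSum_eq_sum_gammaTerm, gammaSum_eq_sum_gammaTerm, Finset.sum_comm (s := Finset.Icc 1 p),
    Finset.sum_range_succ' _ N, Finset.sum_range_succ' _ N, Finset.sum_range_succ' _ N]
  linear_combination -hs - h0

/-! ### The closed form of the moment and its logarithm for large `n` -/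

/-- The closed form of the `p`-th moment of the sphericity statistic of an `n × (r + n)` Gaussian
matrix. -/
def momentFormula (p n r : ℕ) : ℝ :=
  (∏ k ∈ Finset.Icc 1 p, (((r + n : ℕ) : ℝ) - (k : ℝ) / n)) *
    ∏ i ∈ Finset.range n,
      Real.Gamma ((r + i : ℕ) + 1 - (p : ℝ) / n) / Real.Gamma ((r + i : ℕ) + 1)

section

variable {p n r : ℕ}

lemma div_lt_of_lt_mul (hn : 0 < n) (h : p < n * (r + 1)) : (p : ℝ) / n < (r : ℝ) + 1 := by
  have hn' : (0 : ℝ) < n := by exact_mod_cast hn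
  rw [div_lt_iff₀ hn']
  have : (p : ℝ) < n * (r + 1) := by exact_mod_cast h
  linarith

lemma momentFormula_factor_pos (hn : 0 < n) (h : p < n * (r + 1)) {k : ℕ}
    (hk : k ∈ Finset.Icc 1 p) : 0 < ((r + n : ℕ) : ℝ) - (k : ℝ) / n := by
  have h1 := div_lt_of_lt_mul hn h
  have hn' : (1 : ℝ) ≤ n := by exact_mod_cast hn
  have hkp : (k : ℝ) ≤ p := by exact_mod_cast (Finset.mem_Icc.mp hk).2
  have h2 : (k : ℝ) / n ≤ p / n := by gcongr
  push_cast
  linarith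

lemma momentFormula_Gamma_pos (hn : 0 < n) (h : p < n * (r + 1)) (i : ℕ) :
    0 < Real.Gamma ((r + i : ℕ) + 1 - (p : ℝ) / n) := by
  apply Real.Gamma_pos_of_pos
  have h1 := div_lt_of_lt_mul hn h
  push_cast
  linarith [(Nat.cast_nonneg i : (0 : ℝ) ≤ i)]

lemma momentFormula_pos (hn : 0 < n) (h : p < n * (r + 1)) : 0 < momentFormula p n r :=
  mul_pos (Finset.prod_pos fun _ hk => momentFormula_factor_pos hn h hk)
    (Finset.prod_pos fun i _ => div_pos (momentFormula_Gamma_pos hn h i)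
      (Real.Gamma_pos_of_pos (by positivity)))

lemma log_momentFormula (hn : 0 < n) (h : p < n * (r + 1)) :
    Real.log (momentFormula p n r)
      = ∑ k ∈ Finset.Icc 1 p, Real.log (((r + n : ℕ) : ℝ) - (k : ℝ) / n)
        + ∑ i ∈ Finset.range n, (Real.log (Real.Gamma ((r + i : ℕ) + 1 - (p : ℝ) / n))
          - Real.log (Real.Gamma ((r + i : ℕ) + 1))) := by
  have hG : ∀ i : ℕ, 0 < Real.Gamma ((r + i : ℕ) + 1) := fun i =>
    Real.Gamma_pos_of_pos (by positivity)
  rw [momentFormula, Real.log_mul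
    (Finset.prod_pos fun _ hk => momentFormula_factor_pos hn h hk).ne'
    (Finset.prod_pos fun i _ => div_pos (momentFormula_Gamma_pos hn h i) (hG i)).ne',
    Real.log_prod fun k hk => (momentFormula_factor_pos hn h hk).ne',
    Real.log_prod fun i _ => (div_pos (momentFormula_Gamma_pos hn h i) (hG i)).ne']
  congr 1
  exact Finset.sum_congr rfl fun i _ =>
    Real.log_div (momentFormula_Gamma_pos hn h i).ne' (hG i).ne'

end

/-- The expansion of the logarithm of the moment, for large `n`. -/
lemma abs_log_momentFormula_sub_le_of_large (p N : ℕ) {b : ℝ} (hb : b < 1) :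
    ∃ C : ℝ, 0 ≤ C ∧ ∃ n₀ : ℕ, ∀ n r : ℕ, n₀ ≤ n → (n : ℝ) / (r + n : ℕ) ≤ b →
      |Real.log (momentFormula p n r)
        - ∑ q ∈ Finset.range (N + 1), coeffA p ((n : ℝ) / (r + n : ℕ)) q / (n : ℝ) ^ (2 * q)|
        ≤ C / (n : ℝ) ^ (2 * (N + 1)) := by
  have hδ : 0 < 1 - b := by linarith
  obtain ⟨E, hE0, hE⟩ := abs_sum_log_Gamma_sub_gammaSum_le N (Nat.cast_nonneg (α := ℝ) p) hδ
  obtain ⟨n₁, hn₁⟩ := exists_nat_ge (2 / (1 - b))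
  -- `n₁ ≤ n` makes `r ≥ 2`; `p + 2 ≤ n` makes `p / n < 1` and `p / n² ≤ 1 / 2`
  refine ⟨E + p * (2 * (p : ℝ) ^ (N + 1)), by positivity, max n₁ (p + 2), fun n r hn hc => ?_⟩
  have hnp : p + 2 ≤ n := (le_max_right _ _).trans hn
  have hn0 : 0 < n := by omega
  have hn' : (0 : ℝ) < n := by exact_mod_cast hn0
  have hnp' : (p : ℝ) + 2 ≤ n := by exact_mod_cast hnp
  have hδn : 2 ≤ (1 - b) * n := by
    have : (n₁ : ℝ) ≤ n := by exact_mod_cast (le_max_left _ _).trans hn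
    have := hn₁.trans this
    rwa [div_le_iff₀ hδ, mul_comm] at this
  set m : ℝ := ((r + n : ℕ) : ℝ) with hm
  have hm0 : 0 < m := by rw [hm]; positivity
  have hmr : m = r + n := by rw [hm]; push_cast; rfl
  set c : ℝ := (n : ℝ) / m with hcdef
  have hc0 : 0 < c := by positivity
  have hc1 : c < 1 := by linarith
  have hnc : (n : ℝ) / c = m := by rw [hcdef]; field_simp
  have hncr : (n : ℝ) * (1 - c) / c = r := by
    rw [mul_div_right_comm, hnc, hcdef]
    field_simp
    linarith
  have hrδ : (1 - b) * n ≤ r := by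
    rw [← hncr, le_div_iff₀ hc0]
    nlinarith
  have hr2 : 2 ≤ r := by exact_mod_cast hδn.trans hrδ
  have hs1 : (p : ℝ) / n < 1 := by rw [div_lt_one hn']; linarith
  have hlt : p < n * (r + 1) := by nlinarith
  have h1 := hE n r ((p : ℝ) / n) hn0 (by positivity) hs1 le_rfl hrδ hr2
  have h2 := sum_coeffA_eq N p hn' hc0 hc1
  rw [hnc, hncr] at h2
  have h3 : |∑ k ∈ Finset.Icc 1 p, (∑ q ∈ Finset.range N,
          ((k : ℝ) * c / n ^ 2) ^ (q + 1) / ((q : ℝ) + 1) + Real.log (1 - (k : ℝ) * c / n ^ 2))|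
      ≤ p * (2 * (p : ℝ) ^ (N + 1)) / (n : ℝ) ^ (2 * (N + 1)) := by
    refine (Finset.abs_sum_le_sum_abs _ _).trans ?_
    calc _ ≤ ∑ k ∈ Finset.Icc 1 p, 2 * (p : ℝ) ^ (N + 1) / (n : ℝ) ^ (2 * (N + 1)) := by
          refine Finset.sum_le_sum fun k hk => ?_
          have hkp : (k : ℝ) ≤ p := by exact_mod_cast (Finset.mem_Icc.mp hk).2
          have hu0 : 0 ≤ (k : ℝ) * c / n ^ 2 := by positivity
          have hup : (k : ℝ) * c / n ^ 2 ≤ p / n ^ 2 := by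
            gcongr
            nlinarith [(Nat.cast_nonneg k : (0 : ℝ) ≤ k)]
          have hu : (k : ℝ) * c / n ^ 2 ≤ 1 / 2 := by
            refine hup.trans ?_
            rw [div_le_iff₀ (by positivity)]
            nlinarith
          have h4 := Real.abs_log_sub_add_sum_range_le
            (x := (k : ℝ) * c / n ^ 2) (by rw [abs_of_nonneg hu0]; linarith) N
          rw [abs_of_nonneg hu0] at h4
          refine h4.trans ?_
          calc _ ≤ ((p : ℝ) / n ^ 2) ^ (N + 1) / (1 / 2) := by gcongr; linarith
            _ = _ := by rw [div_pow, ← pow_mul]; ring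
      _ = _ := by simp; ring
  have h5 : ∑ k ∈ Finset.Icc 1 p, Real.log (m - (k : ℝ) / n)
      = p * Real.log m + ∑ k ∈ Finset.Icc 1 p, Real.log (1 - (k : ℝ) * c / n ^ 2) := by
    rw [show (p : ℝ) * Real.log m = ∑ k ∈ Finset.Icc 1 p, Real.log m by simp,
      ← Finset.sum_add_distrib]
    refine Finset.sum_congr rfl fun k hk => ?_
    have hpos := momentFormula_factor_pos hn0 hlt hk
    have e : m - (k : ℝ) / n = m * (1 - (k : ℝ) * c / n ^ 2) := by
      rw [hcdef]; field_simp
    rw [← hm, e] at hpos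
    rw [e, Real.log_mul hm0.ne' (pos_of_mul_pos_right hpos hm0.le).ne']
  rw [log_momentFormula hn0 hlt, ← hm, h5, ← h2]
  rw [Finset.sum_add_distrib] at h3
  rw [← hm] at h1
  rw [add_div, show 2 * (N + 1) = 2 * N + 2 by ring] at *
  refine le_trans (le_of_eq ?_) ((abs_add_le _ _).trans (add_le_add h1 h3))
  congr 1
  ring

/-! ### Exponentiating an asymptotic expansion -/

lemma abs_exp_sub_sum_le (z : ℝ) (N : ℕ) :
    |Real.exp z - ∑ i ∈ Finset.range N, z ^ i / (i.factorial : ℝ)| ≤ |z| ^ N * Real.exp |z| := by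
  have h := Complex.norm_exp_sub_sum_le_norm_mul_exp (z : ℂ) N
  rw [Complex.norm_real, Real.norm_eq_abs] at h
  convert h using 1
  rw [← Real.norm_eq_abs, ← Complex.norm_real]
  push_cast
  rfl

lemma abs_prod_sub_prod_le {ι : Type*} (t : Finset ι) {f g : ι → ℝ} {M ε : ℝ}
    (hM : 1 ≤ M) (hf : ∀ i ∈ t, |f i| ≤ M) (hg : ∀ i ∈ t, |g i| ≤ M)
    (hfg : ∀ i ∈ t, |f i - g i| ≤ ε) :
    |∏ i ∈ t, f i - ∏ i ∈ t, g i| ≤ t.card * M ^ t.card * ε := by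
  classical
  induction t using Finset.induction_on with
  | empty => simp
  | insert a t ha ih =>
    rw [Finset.prod_insert ha, Finset.prod_insert ha, Finset.card_insert_of_notMem ha]
    have ih' := ih (fun i hi => hf i (Finset.mem_insert_of_mem hi))
      (fun i hi => hg i (Finset.mem_insert_of_mem hi))
      (fun i hi => hfg i (Finset.mem_insert_of_mem hi))
    have hε : 0 ≤ ε := (abs_nonneg _).trans (hfg a (Finset.mem_insert_self _ _))
    have hgp : |∏ i ∈ t, g i| ≤ M ^ (t.card + 1) := by
      rw [Finset.abs_prod]
      calc _ ≤ ∏ i ∈ t, M := Finset.prod_le_prod (fun i _ => abs_nonneg _)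
            fun i hi => hg i (Finset.mem_insert_of_mem hi)
        _ = M ^ t.card := by simp
        _ ≤ _ := pow_le_pow_right₀ hM (Nat.le_succ _)
    calc |f a * ∏ i ∈ t, f i - g a * ∏ i ∈ t, g i|
        = |f a * (∏ i ∈ t, f i - ∏ i ∈ t, g i) + (f a - g a) * ∏ i ∈ t, g i| := by ring_nf
      _ ≤ |f a| * |∏ i ∈ t, f i - ∏ i ∈ t, g i| + |f a - g a| * |∏ i ∈ t, g i| := by
          rw [← abs_mul, ← abs_mul]; exact abs_add_le _ _
      _ ≤ M * (t.card * M ^ t.card * ε) + ε * M ^ (t.card + 1) := by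
          gcongr
          · exact hf a (Finset.mem_insert_self _ _)
          · exact hfg a (Finset.mem_insert_self _ _)
      _ = _ := by push_cast; ring

/-- The weight `i₁ + 2 i₂ + ⋯` of a multi-index. -/
def multiWeight {N : ℕ} (i : Fin N → ℕ) : ℕ := ∑ r : Fin N, ((r : ℕ) + 1) * i r

lemma le_multiWeight {N : ℕ} (i : Fin N → ℕ) (r : Fin N) : ((r : ℕ) + 1) * i r ≤ multiWeight i :=
  Finset.single_le_sum (f := fun r : Fin N => ((r : ℕ) + 1) * i r) (fun _ _ => Nat.zero_le _)
    (Finset.mem_univ r)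

lemma mem_weightedSolutions {j : ℕ} (i : Fin j → ℕ) :
    i ∈ weightedSolutions j ↔ multiWeight i = j := by
  simp only [weightedSolutions, Finset.mem_filter, Fintype.mem_piFinset, Finset.mem_range]
  refine and_iff_right_of_imp fun h r => ?_
  have := (le_multiWeight i r).trans_eq h
  nlinarith

/-- Multi-indices of weight `j ≤ N` have no entry beyond the `j`-th. -/
lemma sum_multiWeight_eq_sum_weightedSolutions (A : ℕ → ℝ) {N j : ℕ} (hj : j ≤ N) :
    ∑ i ∈ (Fintype.piFinset fun _ : Fin N => Finset.range (N + 1)).filter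
        (fun i => multiWeight i = j), ∏ r : Fin N, A ((r : ℕ) + 1) ^ i r / ((i r).factorial : ℝ)
      = ∑ i ∈ weightedSolutions j, ∏ r : Fin j, A ((r : ℕ) + 1) ^ i r / ((i r).factorial : ℝ) := by
  obtain ⟨d, rfl⟩ := Nat.exists_eq_add_of_le hj
  have hw : ∀ i : Fin (j + d) → ℕ, multiWeight i = multiWeight (fun r => i (Fin.castAdd d r))
      + ∑ r : Fin d, (j + (r : ℕ) + 1) * i (Fin.natAdd j r) := by
    intro i
    simp [multiWeight, Fin.sum_univ_add]
  have hz : ∀ i : Fin (j + d) → ℕ, multiWeight i = j → ∀ r : Fin d, i (Fin.natAdd j r) = 0 := by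
    intro i hi r
    have := le_multiWeight i (Fin.natAdd j r)
    rw [hi, Fin.val_natAdd] at this
    by_contra hne
    have : 1 ≤ i (Fin.natAdd j r) := Nat.one_le_iff_ne_zero.mpr hne
    nlinarith
  refine Finset.sum_nbij' (fun i r => i (Fin.castAdd d r))
    (fun k => Fin.append k (fun _ => 0)) ?_ ?_ ?_ ?_ ?_
  · intro i hi
    have hi' := (Finset.mem_filter.mp hi).2
    have h := hw i
    simp only [hz i hi', mul_zero, Finset.sum_const_zero, add_zero] at h
    rw [mem_weightedSolutions, ← h, hi']
  · intro k hk
    rw [mem_weightedSolutions] at hk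
    rw [Finset.mem_filter]
    have h : multiWeight (Fin.append k (fun _ : Fin d => 0)) = j := by
      rw [hw]; simpa using hk
    refine ⟨?_, h⟩
    rw [Fintype.mem_piFinset]
    intro r
    have := le_multiWeight (Fin.append k (fun _ : Fin d => 0)) r
    rw [h] at this
    rw [Finset.mem_range]
    nlinarith
  · intro i hi
    have hi' := (Finset.mem_filter.mp hi).2
    funext r
    refine Fin.addCases (fun r => ?_) (fun r => ?_) r
    · simp
    · simp [hz i hi' r]
  · intro k _
    funext r
    simp
  · intro i hi
    have hi' := (Finset.mem_filter.mp hi).2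
    rw [Fin.prod_univ_add]
    simp [hz i hi']

/-- Exponentiating an asymptotic expansion: the coefficients of `exp (∑ A_q y^q)`. -/
lemma abs_exp_sub_sum_weightedSolutions_le (N : ℕ) (K : ℝ) :
    ∃ C : ℝ, 0 ≤ C ∧ ∀ (A : ℕ → ℝ) (y : ℝ), (∀ q ≤ N, |A q| ≤ K) → 0 ≤ y → y ≤ 1 →
      |Real.exp (∑ q ∈ Finset.range N, A (q + 1) * y ^ (q + 1))
        - ∑ j ∈ Finset.range (N + 1), (∑ i ∈ weightedSolutions j,
          ∏ r : Fin j, A ((r : ℕ) + 1) ^ i r / ((i r).factorial : ℝ)) * y ^ j|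
        ≤ C * y ^ (N + 1) := by
  refine ⟨N * Real.exp |K| ^ N * (|K| ^ (N + 1) * Real.exp |K|) + Real.exp |K| ^ N, by positivity,
    fun A y hA hy0 hy1 => ?_⟩
  have hM : 1 ≤ Real.exp |K| := Real.one_le_exp (abs_nonneg K)
  have hA' : ∀ r : Fin N, |A ((r : ℕ) + 1)| ≤ |K| := fun r =>
    (hA _ r.2).trans (le_abs_self K)
  set z : Fin N → ℝ := fun r => A ((r : ℕ) + 1) * y ^ ((r : ℕ) + 1) with hz
  have hzy : ∀ r, |z r| ≤ |K| * y := fun r => by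
    rw [hz, abs_mul, abs_pow, abs_of_nonneg hy0]
    have : y ^ ((r : ℕ) + 1) ≤ y := by simpa using pow_le_of_le_one hy0 hy1 (Nat.succ_ne_zero r)
    exact mul_le_mul (hA' r) this (by positivity) (abs_nonneg _)
  have hzK : ∀ r, |z r| ≤ |K| := fun r =>
    (hzy r).trans (mul_le_of_le_one_right (abs_nonneg K) hy1)
  have hb : ∀ x : ℝ, |x| ≤ |K| →
      ∑ i ∈ Finset.range (N + 1), |x ^ i / (i.factorial : ℝ)| ≤ Real.exp |K| := by
    intro x hx
    refine le_trans (le_of_eq ?_) ((Real.sum_le_exp_of_nonneg (abs_nonneg x) (N + 1)).trans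
      (Real.exp_le_exp.mpr hx))
    exact Finset.sum_congr rfl fun i _ => by rw [abs_div, abs_pow, Nat.abs_cast]
  have h1 := abs_prod_sub_prod_le (Finset.univ : Finset (Fin N)) (f := fun r => Real.exp (z r))
    (g := fun r => ∑ i ∈ Finset.range (N + 1), z r ^ i / (i.factorial : ℝ)) (M := Real.exp |K|)
    (ε := |K| ^ (N + 1) * Real.exp |K| * y ^ (N + 1)) hM
    (fun r _ => by
      rw [Real.abs_exp]; exact Real.exp_le_exp.mpr ((le_abs_self _).trans (hzK r)))
    (fun r _ => (Finset.abs_sum_le_sum_abs _ _).trans (hb _ (hzK r)))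
    (fun r _ => by
      refine (abs_exp_sub_sum_le (z r) (N + 1)).trans ?_
      calc _ ≤ (|K| * y) ^ (N + 1) * Real.exp |K| := by
            exact mul_le_mul (pow_le_pow_left₀ (abs_nonneg _) (hzy r) _)
              (Real.exp_le_exp.mpr (hzK r)) (Real.exp_nonneg _) (by positivity)
        _ = _ := by rw [mul_pow]; ring)
  rw [← Real.exp_sum, Finset.prod_univ_sum, Finset.card_univ, Fintype.card_fin] at h1
  set S := Fintype.piFinset fun _ : Fin N => Finset.range (N + 1) with hS
  set w : (Fin N → ℕ) → ℝ := fun i => ∏ r : Fin N, A ((r : ℕ) + 1) ^ i r / ((i r).factorial : ℝ)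
    with hw
  have h2 : ∀ i : Fin N → ℕ, ∏ r, z r ^ i r / ((i r).factorial : ℝ) = w i * y ^ multiWeight i := by
    intro i
    rw [multiWeight, ← Finset.prod_pow_eq_pow_sum, hw, ← Finset.prod_mul_distrib]
    exact Finset.prod_congr rfl fun r _ => by rw [hz, mul_pow, ← pow_mul]; ring
  simp only [h2] at h1
  have h3 : ∑ i ∈ S, w i * y ^ multiWeight i
      = ∑ j ∈ Finset.range (N + 1), (∑ i ∈ weightedSolutions j,
          ∏ r : Fin j, A ((r : ℕ) + 1) ^ i r / ((i r).factorial : ℝ)) * y ^ j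
        + ∑ i ∈ S.filter (fun i => ¬ multiWeight i < N + 1), w i * y ^ multiWeight i := by
    rw [← Finset.sum_filter_add_sum_filter_not S (fun i => multiWeight i < N + 1)]
    congr 1
    rw [← Finset.sum_fiberwise_of_maps_to (g := multiWeight) (t := Finset.range (N + 1))
      (fun i hi => Finset.mem_range.mpr (Finset.mem_filter.mp hi).2)]
    refine Finset.sum_congr rfl fun j hj => ?_
    have hj' := Finset.mem_range.mp hj
    rw [← sum_multiWeight_eq_sum_weightedSolutions A (Nat.lt_succ_iff.mp hj'), Finset.sum_mul,
      Finset.filter_filter]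
    refine Finset.sum_congr ?_ fun i hi => ?_
    · ext i
      simp only [Finset.mem_filter]
      constructor
      · rintro ⟨h, _, h'⟩; exact ⟨h, h'⟩
      · rintro ⟨h, h'⟩; exact ⟨h, h' ▸ hj', h'⟩
    · rw [(Finset.mem_filter.mp hi).2]
  have h4 : |∑ i ∈ S.filter (fun i => ¬ multiWeight i < N + 1), w i * y ^ multiWeight i|
      ≤ Real.exp |K| ^ N * y ^ (N + 1) := by
    calc _ ≤ ∑ i ∈ S.filter (fun i => ¬ multiWeight i < N + 1), |w i| * y ^ (N + 1) := by
          refine (Finset.abs_sum_le_sum_abs _ _).trans (Finset.sum_le_sum fun i hi => ?_)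
          rw [abs_mul, abs_pow, abs_of_nonneg hy0]
          refine mul_le_mul_of_nonneg_left ?_ (abs_nonneg _)
          exact pow_le_pow_of_le_one hy0 hy1 (not_lt.mp (Finset.mem_filter.mp hi).2)
      _ ≤ ∑ i ∈ S, |w i| * y ^ (N + 1) :=
          Finset.sum_le_sum_of_subset_of_nonneg (Finset.filter_subset _ _)
            fun i _ _ => by positivity
      _ = (∏ r : Fin N, ∑ i ∈ Finset.range (N + 1), |A ((r : ℕ) + 1) ^ i / (i.factorial : ℝ)|)
            * y ^ (N + 1) := by
          rw [← Finset.sum_mul, Finset.prod_univ_sum]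
          simp only [hw, Finset.abs_prod, hS]
      _ ≤ (∏ _r : Fin N, Real.exp |K|) * y ^ (N + 1) := by
          gcongr with r
          exact hb _ (hA' r)
      _ = _ := by simp
  have h5 : ∑ q ∈ Finset.range N, A (q + 1) * y ^ (q + 1) = ∑ r, z r :=
    (Fin.sum_univ_eq_sum_range (fun q => A (q + 1) * y ^ (q + 1)) N).symm
  rw [h3] at h1
  rw [h5]
  have h6 := abs_add_le (Real.exp (∑ r, z r) - (∑ j ∈ Finset.range (N + 1),
      (∑ i ∈ weightedSolutions j,
          ∏ r : Fin j, A ((r : ℕ) + 1) ^ i r / ((i r).factorial : ℝ)) * y ^ j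
        + ∑ i ∈ S.filter (fun i => ¬ multiWeight i < N + 1), w i * y ^ multiWeight i))
    (∑ i ∈ S.filter (fun i => ¬ multiWeight i < N + 1), w i * y ^ multiWeight i)
  rw [show ∀ u v w : ℝ, u - (v + w) + w = u - v by intros; ring] at h6
  linarith

lemma coeffBeta_eq (p : ℕ) (c : ℝ) (j : ℕ) :
    coeffBeta p c j = Real.exp (coeffA p c 0) * ∑ i ∈ weightedSolutions j,
        ∏ r : Fin j, coeffA p c ((r : ℕ) + 1) ^ i r / ((i r).factorial : ℝ) := by
  rw [coeffBeta]
  split_ifs with h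
  · subst h
    have : weightedSolutions 0 = {default} := by
      ext i
      simp [mem_weightedSolutions, multiWeight, Subsingleton.elim i default]
    rw [this]
    simp
  · rfl

lemma continuousAt_coeffA (p q : ℕ) {c : ℝ} (hc0 : 0 < c) (hc1 : c < 1) :
    ContinuousAt (fun c => coeffA p c q) c := by
  have h0 : c ≠ 0 := hc0.ne'
  have h1 : 1 - c ≠ 0 := by linarith
  have h2 : c - 1 ≠ 0 := by linarith
  unfold coeffA
  rcases Nat.lt_or_ge q 2 with hq | hq
  · interval_cases q
    · simp only [if_true]
      fun_prop (disch := assumption)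
    · simp only [one_ne_zero, if_false, if_true]
      fun_prop (disch := first | assumption | simpa using h2)
  · have hq0 : q ≠ 0 := by omega
    have hq1 : q ≠ 1 := by omega
    have hq2 : (q : ℝ) ≠ 0 := by exact_mod_cast hq0
    have hq3 : -1 + (q : ℝ) ^ 2 ≠ 0 := by
      have : (2 : ℝ) ≤ q := by exact_mod_cast hq
      nlinarith
    simp only [hq0, hq1, if_false]
    have h3 : 12 * c * q * (-1 + (q : ℝ) ^ 2) * (1 - c) ^ q ≠ 0 := by
      simp [*]
    have h4 : 12 * c * q * (-1 + (q : ℝ) ^ 2) ≠ 0 := by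
      simp [*]
    have h5 : ∀ j : ℕ, (1 - c) ^ j ≠ 0 := fun j => pow_ne_zero j h1
    refine ContinuousAt.add (ContinuousAt.sub (ContinuousAt.add ?_ ?_) ?_) ?_
    · fun_prop (disch := assumption)
    · fun_prop (disch := assumption)
    · fun_prop
    · refine tendsto_finsetSum _ fun j hj => ?_
      have h6 := h5 (j + q)
      refine ContinuousAt.mul ?_ ?_
      · fun_prop
      · fun_prop (disch := assumption)

lemma exists_abs_coeffA_le (p N : ℕ) {a b : ℝ} (ha : 0 < a) (hb : b < 1) :
    ∃ K : ℝ, 0 ≤ K ∧ ∀ q ≤ N, ∀ c, a ≤ c → c ≤ b → |coeffA p c q| ≤ K := by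
  have h : ∀ q, ∃ K : ℝ, ∀ c ∈ Set.Icc a b, ‖coeffA p c q‖ ≤ K := fun q =>
    isCompact_Icc.exists_bound_of_continuousOn fun c hc =>
      (continuousAt_coeffA p q (ha.trans_le hc.1) (hc.2.trans_lt hb)).continuousWithinAt
  choose K hK using h
  refine ⟨∑ q ∈ Finset.range (N + 1), |K q|, by positivity, fun q hq c hac hcb => ?_⟩
  refine (hK q c ⟨hac, hcb⟩).trans ((le_abs_self _).trans ?_)
  exact Finset.single_le_sum (f := fun q => |K q|) (fun _ _ => abs_nonneg _)
    (Finset.mem_range.mpr (Nat.lt_succ_of_le hq))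

/-! ### Uniform expansions of the closed form -/

/-- The expansion of the logarithm of the moment. -/
lemma abs_log_momentFormula_sub_le (p N : ℕ) {a b : ℝ} (ha : 0 < a) (hb : b < 1) :
    ∃ C : ℝ, 0 ≤ C ∧ ∀ n r : ℕ, 0 < n → a ≤ (n : ℝ) / (r + n : ℕ) → (n : ℝ) / (r + n : ℕ) ≤ b →
      |Real.log (momentFormula p n r)
        - ∑ q ∈ Finset.range (N + 1), coeffA p ((n : ℝ) / (r + n : ℕ)) q / (n : ℝ) ^ (2 * q)|
        ≤ C / (n : ℝ) ^ (2 * (N + 1)) := by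
  obtain ⟨C, hC0, n₀, hC⟩ := abs_log_momentFormula_sub_le_of_large p N hb
  obtain ⟨R, hR⟩ := exists_nat_ge (n₀ / a)
  set err : ℕ → ℕ → ℝ := fun n r => |Real.log (momentFormula p n r)
        - ∑ q ∈ Finset.range (N + 1), coeffA p ((n : ℝ) / (r + n : ℕ)) q / (n : ℝ) ^ (2 * q)|
  set D : ℝ := ∑ n ∈ Finset.range n₀, ∑ r ∈ Finset.range (R + 1),
    err n r * (n : ℝ) ^ (2 * (N + 1)) with hD
  have herr : ∀ n r, 0 ≤ err n r * (n : ℝ) ^ (2 * (N + 1)) := fun n r =>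
    mul_nonneg (abs_nonneg _) (by positivity)
  have hD0 : 0 ≤ D := Finset.sum_nonneg fun n _ => Finset.sum_nonneg fun r _ => herr n r
  refine ⟨C + D, by positivity, fun n r hn hac hcb => ?_⟩
  have hn' : (0 : ℝ) < n := by exact_mod_cast hn
  rcases Nat.lt_or_ge n n₀ with h | h
  · -- only finitely many pairs `(n, r)` have `n < n₀` and `a ≤ n / (r + n)`
    have hr : r < R + 1 := by
      have h1 : (r : ℝ) ≤ n₀ / a := by
        rw [le_div_iff₀ ha]
        rw [le_div_iff₀ (by positivity)] at hac
        have h2 : (n : ℝ) ≤ n₀ := by exact_mod_cast h.le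
        push_cast at hac
        nlinarith
      exact Nat.lt_succ_of_le (by exact_mod_cast h1.trans hR)
    rw [le_div_iff₀ (by positivity)]
    have h1 : err n r * (n : ℝ) ^ (2 * (N + 1)) ≤ D := by
      rw [hD]
      refine le_trans ?_ (Finset.single_le_sum
        (f := fun n => ∑ r ∈ Finset.range (R + 1), err n r * (n : ℝ) ^ (2 * (N + 1)))
        (fun n _ => Finset.sum_nonneg fun r _ => herr n r) (Finset.mem_range.mpr h))
      exact Finset.single_le_sum (f := fun r => err n r * (n : ℝ) ^ (2 * (N + 1)))
        (fun r _ => herr n r) (Finset.mem_range.mpr hr)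
    exact h1.trans (by linarith)
  · refine (hC n r h hcb).trans ?_
    gcongr
    linarith

/-- An expansion of `log μ` with bounded coefficients gives the expansion of `μ`. -/
lemma abs_sub_coeffBeta_le (p N : ℕ) {a b C : ℝ} (ha : 0 < a) (hb : b < 1) (hC : 0 ≤ C) :
    ∃ C' : ℝ, 0 ≤ C' ∧ ∀ (μ c : ℝ) (n : ℕ), 0 < n → 0 < μ → a ≤ c → c ≤ b →
      |Real.log μ - ∑ q ∈ Finset.range (N + 1), coeffA p c q / (n : ℝ) ^ (2 * q)|
        ≤ C / (n : ℝ) ^ (2 * (N + 1)) →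
      |μ - ∑ j ∈ Finset.range (N + 1), coeffBeta p c j / (n : ℝ) ^ (2 * j)|
        ≤ C' / (n : ℝ) ^ (2 * (N + 1)) := by
  obtain ⟨K, hK0, hK⟩ := exists_abs_coeffA_le p N ha hb
  obtain ⟨D, hD0, hD⟩ := abs_exp_sub_sum_weightedSolutions_le N K
  refine ⟨Real.exp K * (Real.exp (N * K) * (C * Real.exp C) + D), by positivity,
    fun μ c n hn hμ hac hcb h => ?_⟩
  have hn' : (1 : ℝ) ≤ n := by exact_mod_cast hn
  -- the expansion variable is `y = 1 / n²`
  set y : ℝ := ((n : ℝ) ^ 2)⁻¹ with hy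
  have hy0 : 0 ≤ y := by positivity
  have hy1 : y ≤ 1 := inv_le_one_of_one_le₀ (one_le_pow₀ hn')
  have hdiv : ∀ (x : ℝ) (q : ℕ), x / (n : ℝ) ^ (2 * q) = x * y ^ q := fun x q => by
    rw [hy, inv_pow, ← pow_mul]; rfl
  simp only [hdiv] at h ⊢
  have hA : ∀ q ≤ N, |coeffA p c q| ≤ K := fun q hq => hK q hq c hac hcb
  have h1 := hD (coeffA p c) y hA hy0 hy1
  set S : ℝ := ∑ q ∈ Finset.range N, coeffA p c (q + 1) * y ^ (q + 1) with hS
  set ρ : ℝ := Real.log μ - ∑ q ∈ Finset.range (N + 1), coeffA p c q * y ^ q with hρ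
  have hμe : μ = Real.exp (coeffA p c 0) * (Real.exp S * Real.exp ρ) := by
    rw [← Real.exp_add, ← Real.exp_add, hρ, Finset.sum_range_succ', hS]
    conv_lhs => rw [← Real.exp_log hμ]
    congr 1
    ring
  have hSK : S ≤ N * K := by
    calc S ≤ ∑ q ∈ Finset.range N, K := by
          refine Finset.sum_le_sum fun q hq => ?_
          have h2 := hA (q + 1) (Finset.mem_range.mp hq)
          calc _ ≤ |coeffA p c (q + 1) * y ^ (q + 1)| := le_abs_self _
            _ = |coeffA p c (q + 1)| * y ^ (q + 1) := by rw [abs_mul, abs_of_nonneg (pow_nonneg hy0 (q + 1))]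
            _ ≤ K * 1 := mul_le_mul h2 (pow_le_one₀ hy0 hy1) (by positivity) hK0
            _ = K := mul_one K
      _ = _ := by simp
  have hyN : y ^ (N + 1) ≤ 1 := pow_le_one₀ hy0 hy1
  have hρC : |ρ| ≤ C := h.trans (mul_le_of_le_one_right hC hyN)
  have h2 : |Real.exp ρ - 1| ≤ C * y ^ (N + 1) * Real.exp C := by
    have h3 := abs_exp_sub_sum_le ρ 1
    simp only [Finset.sum_range_one, pow_zero, Nat.factorial_zero, Nat.cast_one, div_one,
      pow_one] at h3
    exact h3.trans (mul_le_mul h (Real.exp_le_exp.mpr hρC) (Real.exp_nonneg _) (by positivity))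
  have hβ : ∑ j ∈ Finset.range (N + 1), coeffBeta p c j * y ^ j = Real.exp (coeffA p c 0) *
      ∑ j ∈ Finset.range (N + 1), (∑ i ∈ weightedSolutions j,
        ∏ r : Fin j, coeffA p c ((r : ℕ) + 1) ^ i r / ((i r).factorial : ℝ)) * y ^ j := by
    rw [Finset.mul_sum]
    exact Finset.sum_congr rfl fun j _ => by rw [coeffBeta_eq, mul_assoc]
  rw [hβ, hμe, ← mul_sub, abs_mul, Real.abs_exp]
  have h4 : Real.exp (coeffA p c 0) ≤ Real.exp K :=
    Real.exp_le_exp.mpr ((le_abs_self _).trans (hA 0 (Nat.zero_le N)))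
  rw [mul_assoc]
  refine mul_le_mul h4 ?_ (abs_nonneg _) (Real.exp_nonneg _)
  set T := ∑ j ∈ Finset.range (N + 1), (∑ i ∈ weightedSolutions j,
        ∏ r : Fin j, coeffA p c ((r : ℕ) + 1) ^ i r / ((i r).factorial : ℝ)) * y ^ j
  calc |Real.exp S * Real.exp ρ - T| = |Real.exp S * (Real.exp ρ - 1) + (Real.exp S - T)| := by
        ring_nf
    _ ≤ Real.exp S * |Real.exp ρ - 1| + |Real.exp S - T| := by
        refine (abs_add_le _ _).trans ?_
        rw [abs_mul, Real.abs_exp]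
    _ ≤ Real.exp (N * K) * (C * y ^ (N + 1) * Real.exp C) + D * y ^ (N + 1) := by
        gcongr
    _ = _ := by ring

/-! ### Densities and radial Gaussian integrals -/

lemma lintegral_fin_prod_eq_prod {α : Type*} [MeasurableSpace α] (μ : Measure α) [SigmaFinite μ] :
    ∀ (n : ℕ) (f : Fin n → α → ENNReal), (∀ i, Measurable (f i)) →
      ∫⁻ x, ∏ i, f i (x i) ∂(Measure.pi fun _ : Fin n => μ) = ∏ i, ∫⁻ x, f i x ∂μ := by
  intro n
  induction n with
  | zero => intro f _; simp
  | succ n ih =>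
    intro f hf
    have hmp := measurePreserving_piFinSuccAbove (fun _ : Fin (n + 1) => μ) 0
    rw [← hmp.symm.lintegral_comp_emb (MeasurableEquiv.measurableEmbedding _)]
    simp only [Fin.prod_univ_succ]
    rw [← ih (fun i => f i.succ) fun i => hf _, ← lintegral_prod_mul (hf 0).aemeasurable
      (Finset.measurable_prod _ fun i _ => (hf i.succ).comp (measurable_pi_apply i)).aemeasurable]
    rfl

/-- Finite powers of a measure with density. -/
lemma pi_withDensity {α : Type*} [MeasurableSpace α] (μ : Measure α) [SigmaFinite μ] (n : ℕ)
    (f : α → ENNReal) (hf : Measurable f) [SigmaFinite (μ.withDensity f)] :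
    (Measure.pi fun _ : Fin n => μ.withDensity f)
      = (Measure.pi fun _ : Fin n => μ).withDensity fun x => ∏ i, f (x i) := by
  refine Measure.pi_eq (μ := fun _ : Fin n => μ.withDensity f) fun s hs => ?_
  rw [withDensity_apply _ (MeasurableSet.univ_pi hs), ← lintegral_indicator
    (MeasurableSet.univ_pi hs)]
  have h1 : ∀ i, μ.withDensity f (s i) = ∫⁻ x, (s i).indicator f x ∂μ := fun i => by
    rw [withDensity_apply f (hs i), lintegral_indicator (hs i)]
  rw [Finset.prod_congr rfl fun i _ => h1 i, ← lintegral_fin_prod_eq_prod μ n (fun i => (s i).indicator f)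
    fun i => hf.indicator (hs i)]
  refine lintegral_congr fun x => ?_
  by_cases hx : x ∈ Set.univ.pi s
  · rw [Set.indicator_of_mem hx]
    exact Finset.prod_congr rfl fun i _ => (Set.indicator_of_mem (hx i (Set.mem_univ i)) f).symm
  · rw [Set.indicator_of_notMem hx]
    simp only [Set.mem_univ_pi, not_forall] at hx
    obtain ⟨i, hi⟩ := hx
    exact (Finset.prod_eq_zero (Finset.mem_univ i) (Set.indicator_of_notMem hi f)).symm

/-- The density of the complex Gaussian law of variance `v`. -/
def complexGaussianDensity (v : ℝ≥0) (z : ℂ) : ENNReal :=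
  ENNReal.ofReal ((Real.pi * v)⁻¹ * Real.exp (-‖z‖ ^ 2 / v))

lemma measurable_complexGaussianDensity (v : ℝ≥0) : Measurable (complexGaussianDensity v) := by
  unfold complexGaussianDensity
  fun_prop

lemma complexGaussian_eq_withDensity {v : ℝ≥0} (hv : 0 < v) :
    complexGaussian v = volume.withDensity (complexGaussianDensity v) := by
  have hv2 : v / 2 ≠ 0 := by positivity
  have hv' : (0 : ℝ) < v := by exact_mod_cast hv
  have hmp := Complex.volume_preserving_equiv_real_prod.symm
  have hfun : (fun z : ℝ × ℝ => (z.1 : ℂ) + (z.2 : ℂ) * Complex.I)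
      = Complex.measurableEquivRealProd.symm := by
    funext z
    apply Complex.ext <;> simp [Complex.measurableEquivRealProd_symm_apply]
  rw [complexGaussian, gaussianReal_of_var_ne_zero _ hv2, prod_withDensity
    (measurable_gaussianPDF _ _) (measurable_gaussianPDF _ _), hfun]
  ext s hs
  rw [Measure.map_apply (MeasurableEquiv.measurable _) hs, withDensity_apply _ hs,
    withDensity_apply _ (MeasurableEquiv.measurable _ hs),
    ← hmp.setLIntegral_comp_preimage_emb (MeasurableEquiv.measurableEmbedding _)]
  refine lintegral_congr fun z => ?_
  rw [gaussianPDF, gaussianPDF, ← ENNReal.ofReal_mul (gaussianPDFReal_nonneg _ _ _),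
    complexGaussianDensity, gaussianPDFReal, gaussianPDFReal]
  congr 1
  have h1 : ‖Complex.measurableEquivRealProd.symm z‖ ^ 2 = z.1 ^ 2 + z.2 ^ 2 := by
    rw [← Complex.normSq_eq_norm_sq, Complex.normSq_apply]
    simp [Complex.measurableEquivRealProd_symm_apply]
    ring
  have h2 : 2 * Real.pi * ((v / 2 : ℝ≥0) : ℝ) = Real.pi * v := by push_cast; ring
  have h3 : 2 * ((v / 2 : ℝ≥0) : ℝ) = v := by push_cast; ring
  rw [h1, h2, h3, mul_mul_mul_comm, ← mul_inv, Real.mul_self_sqrt (by positivity), ← Real.exp_add]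
  congr 2
  ring

instance (v : ℝ≥0) : IsProbabilityMeasure (complexGaussian v) :=
  Measure.isProbabilityMeasure_map (by fun_prop)

/-- The law of a row of a complex Gaussian matrix has a density. -/
lemma pi_complexGaussian_eq_withDensity (m : ℕ) {v : ℝ≥0} (hv : 0 < v) :
    (Measure.pi fun _ : Fin m => complexGaussian v)
      = volume.withDensity fun x => ENNReal.ofReal
        ((Real.pi * v)⁻¹ ^ m * Real.exp (-(∑ i, ‖x i‖ ^ 2) / v)) := by
  have h := complexGaussian_eq_withDensity hv
  have : SigmaFinite ((volume : Measure ℂ).withDensity (complexGaussianDensity v)) := by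
    rw [← h]; infer_instance
  rw [h, pi_withDensity _ _ _ (measurable_complexGaussianDensity v), volume_pi]
  congr 1
  funext x
  simp only [complexGaussianDensity]
  rw [← ENNReal.ofReal_prod_of_nonneg fun i _ => by positivity, Finset.prod_mul_distrib,
    ← Real.exp_sum, Finset.prod_const, Finset.card_univ, Fintype.card_fin]
  congr 3
  rw [← Finset.sum_div, Finset.sum_neg_distrib]

lemma complexGaussianMatrix_eq_withDensity (n m : ℕ) {v : ℝ≥0} (hv : 0 < v) :
    complexGaussianMatrix n m v = volume.withDensity fun X => ENNReal.ofReal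
        (((Real.pi * v)⁻¹ ^ m) ^ n * Real.exp (-(∑ i, ∑ j, ‖X i j‖ ^ 2) / v)) := by
  have h := pi_complexGaussian_eq_withDensity m hv
  have : SigmaFinite ((volume : Measure (Fin m → ℂ)).withDensity fun x => ENNReal.ofReal
        ((Real.pi * v)⁻¹ ^ m * Real.exp (-(∑ i, ‖x i‖ ^ 2) / v))) := by
    rw [← h]; infer_instance
  rw [complexGaussianMatrix, h, pi_withDensity _ _ _ (by fun_prop), volume_pi]
  congr 1
  funext x
  rw [← ENNReal.ofReal_prod_of_nonneg fun i _ => by positivity, Finset.prod_mul_distrib,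
    ← Real.exp_sum, Finset.prod_const, Finset.card_univ, Fintype.card_fin]
  congr 3
  rw [← Finset.sum_div, Finset.sum_neg_distrib]

instance (n m : ℕ) (v : ℝ≥0) : IsProbabilityMeasure (complexGaussianMatrix n m v) := by
  unfold complexGaussianMatrix; infer_instance

open Module in
/-- Negative moments of the squared norm under a Gaussian weight on a space of even dimension, up
to a normalization that does not depend on the order `s`. -/
lemma lintegral_rpow_norm_mul_exp {W : Type*} [NormedAddCommGroup W] [NormedSpace ℝ W]
    [FiniteDimensional ℝ W] [MeasurableSpace W] [BorelSpace W] (μ : Measure W)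
    [μ.IsAddHaarMeasure] {d : ℕ} (hd : finrank ℝ W = 2 * d) (hd0 : 0 < d) {s v : ℝ} (hs : s < d)
    (hv : 0 < v) :
    ∫⁻ w, ENNReal.ofReal ((‖w‖ ^ 2) ^ (-s) * Real.exp (-‖w‖ ^ 2 / v)) ∂μ
      = ENNReal.ofReal (d * μ.real (Metric.ball 0 1)) *
        ENNReal.ofReal (v ^ ((d : ℝ) - s) * Real.Gamma (d - s)) := by
  have : Nontrivial W := nontrivial_of_finrank_pos (R := ℝ) (by omega)
  set f : ℝ → ℝ := fun y => (y ^ 2) ^ (-s) * Real.exp (-y ^ 2 / v) with hf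
  have hfe : Set.EqOn (fun y : ℝ => y ^ (2 * ((d : ℝ) - s) - 1) * Real.exp (-v⁻¹ * y ^ (2 : ℝ)))
      (fun y : ℝ => y ^ (finrank ℝ W - 1) • f y) (Set.Ioi 0) := by
    intro y hy
    have hy0 : (0 : ℝ) < y := hy
    simp only [hf, smul_eq_mul, hd]
    rw [← mul_assoc, ← Real.rpow_natCast y (2 * d - 1), ← Real.rpow_natCast y 2,
      ← Real.rpow_mul hy0.le, ← Real.rpow_add hy0]
    push_cast [Nat.cast_sub (show 1 ≤ 2 * d by omega)]
    congr 2 <;> ring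
  have hq : -1 < 2 * ((d : ℝ) - s) - 1 := by linarith
  have hint : Integrable (fun w => f ‖w‖) μ := by
    rw [integrable_fun_norm_addHaar]
    exact (integrableOn_rpow_mul_exp_neg_mul_rpow hq two_pos (inv_pos.mpr hv)).congr_fun hfe
      measurableSet_Ioi
  have hval : ∫ w, f ‖w‖ ∂μ
      = (d * μ.real (Metric.ball 0 1)) * (v ^ ((d : ℝ) - s) * Real.Gamma (d - s)) := by
    rw [integral_fun_norm_addHaar, ← setIntegral_congr_fun measurableSet_Ioi hfe,
      integral_rpow_mul_exp_neg_mul_rpow two_pos hq (inv_pos.mpr hv), hd]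
    have e1 : (2 * ((d : ℝ) - s) - 1 + 1) / 2 = d - s := by ring
    have e2 : -(2 * ((d : ℝ) - s) - 1 + 1) / 2 = -(d - s) := by ring
    rw [e1, e2, Real.inv_rpow hv.le, Real.rpow_neg hv.le, inv_inv, nsmul_eq_mul, smul_eq_mul]
    push_cast
    ring
  rw [← ENNReal.ofReal_mul (by positivity), ← hval, ofReal_integral_eq_lintegral_ofReal hint]
  exact Filter.Eventually.of_forall fun w => by positivity

/-! ### The distance of a Gaussian vector to a subspace -/

open Module in
/-- The moments of the squared distance of a Gaussian vector to a subspace, which has a Gamma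
law. -/
lemma lintegral_rpow_norm_starProjection {m k : ℕ} (V : Submodule ℂ (EuclideanSpace ℂ (Fin m)))
    (hV : finrank ℂ V = k) (hk : k < m) {v : ℝ≥0} (hv : 0 < v) {s : ℝ} (hs : s < (m : ℝ) - k) :
    ∫⁻ x, ENNReal.ofReal ((‖Vᗮ.starProjection (WithLp.toLp 2 x)‖ ^ 2) ^ (-s))
        ∂(Measure.pi fun _ : Fin m => complexGaussian v)
      = ENNReal.ofReal ((v : ℝ) ^ (-s) * Real.Gamma ((m : ℝ) - k - s) / Real.Gamma ((m : ℝ) - k)) := by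
  have hv' : (0 : ℝ) < v := by exact_mod_cast hv
  have hW : finrank ℂ Vᗮ = m - k := by
    have := V.finrank_add_finrank_orthogonal
    rw [hV, finrank_euclideanSpace, Fintype.card_fin] at this
    omega
  have hWr : finrank ℝ Vᗮ = 2 * (m - k) := by rw [finrank_real_of_complex, hW]
  have hd : ((m - k : ℕ) : ℝ) = (m : ℝ) - k := by rw [Nat.cast_sub hk.le]
  let L₀ : (V × Vᗮ) ≃ₗ[ℂ] (Fin m → ℂ) :=
    (V.prodEquivOfIsCompl Vᗮ V.isCompl_orthogonal).trans
      (WithLp.linearEquiv 2 ℂ (Fin m → ℂ))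
  let L : (V × Vᗮ) ≃L[ℝ] (Fin m → ℂ) := (L₀.restrictScalars ℝ).toContinuousLinearEquiv
  have hL : ∀ z : V × Vᗮ, WithLp.toLp 2 (L z) = (z.1 : EuclideanSpace ℂ (Fin m)) + z.2 := fun z => rfl
  have hμ : (volume : Measure (Fin m → ℂ)) = Measure.addHaarScalarFactor volume
      (Measure.map L ((Measure.addHaar : Measure V).prod (Measure.addHaar : Measure Vᗮ))) •
      Measure.map L ((Measure.addHaar : Measure V).prod (Measure.addHaar : Measure Vᗮ)) :=
    Measure.isAddLeftInvariant_eq_smul _ _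
  set c := Measure.addHaarScalarFactor (volume : Measure (Fin m → ℂ))
      (Measure.map L ((Measure.addHaar : Measure V).prod (Measure.addHaar : Measure Vᗮ))) with hc
  have hmeas : ∀ s : ℝ, Measurable fun x : Fin m → ℂ =>
      ENNReal.ofReal ((‖Vᗮ.starProjection (WithLp.toLp 2 x)‖ ^ 2) ^ (-s)) := by
    intro s
    have h1 : Measurable fun x : Fin m → ℂ => Vᗮ.starProjection (WithLp.toLp 2 x) :=
      (Vᗮ.starProjection.continuous.comp (PiLp.continuous_toLp 2 _)).measurable
    fun_prop
  -- the value of the integral up to a factor independent of `s`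
  obtain ⟨Q, hQ⟩ : ∃ Q : ENNReal, ∀ s : ℝ, s < (m : ℝ) - k →
      ∫⁻ x, ENNReal.ofReal ((‖Vᗮ.starProjection (WithLp.toLp 2 x)‖ ^ 2) ^ (-s))
        ∂(Measure.pi fun _ : Fin m => complexGaussian v)
      = Q * ENNReal.ofReal ((v : ℝ) ^ ((m : ℝ) - k - s) * Real.Gamma ((m : ℝ) - k - s)) := by
    refine ⟨c * (ENNReal.ofReal ((Real.pi * v)⁻¹ ^ m) *
      (∫⁻ u : V, ENNReal.ofReal (Real.exp (-‖u‖ ^ 2 / v)) ∂Measure.addHaar)) *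
      ENNReal.ofReal (((m - k : ℕ) : ℝ) *
        (Measure.addHaar : Measure Vᗮ).real (Metric.ball 0 1)), fun s hs => ?_⟩
    have hrad := lintegral_rpow_norm_mul_exp (Measure.addHaar : Measure Vᗮ) hWr (by omega)
      (s := s) (v := v) (by rw [hd]; exact hs) hv'
    rw [hd] at hrad ⊢
    rw [pi_complexGaussian_eq_withDensity m hv, lintegral_withDensity_eq_lintegral_mul _
      (by fun_prop) (hmeas s), hμ, lintegral_smul_measure, lintegral_map _ L.continuous.measurable]
    · have hpt : ∀ z : V × Vᗮ, ((fun x : Fin m → ℂ => ENNReal.ofReal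
          ((Real.pi * v)⁻¹ ^ m * Real.exp (-(∑ i, ‖x i‖ ^ 2) / v))) * fun x =>
          ENNReal.ofReal ((‖Vᗮ.starProjection (WithLp.toLp 2 x)‖ ^ 2) ^ (-s))) (L z)
          = (ENNReal.ofReal ((Real.pi * v)⁻¹ ^ m) * ENNReal.ofReal (Real.exp (-‖z.1‖ ^ 2 / v)))
            * ENNReal.ofReal ((‖z.2‖ ^ 2) ^ (-s) * Real.exp (-‖z.2‖ ^ 2 / v)) := by
        intro z
        have h1 : ∑ i, ‖L z i‖ ^ 2 = ‖z.1‖ ^ 2 + ‖z.2‖ ^ 2 := by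
          have h2 := EuclideanSpace.norm_sq_eq (WithLp.toLp 2 (L z))
          rw [hL, pow_two, norm_add_sq_eq_norm_sq_add_norm_sq_of_inner_eq_zero (𝕜 := ℂ) _ _
            (Submodule.inner_right_of_mem_orthogonal z.1.2 z.2.2)] at h2
          rw [pow_two, pow_two]
          exact h2.symm
        have h2 : ‖Vᗮ.starProjection (WithLp.toLp 2 (L z))‖ = ‖z.2‖ := by
          rw [hL, map_add, Submodule.starProjection_eq_self_iff.mpr z.2.2,
            Submodule.starProjection_orthogonal_apply_eq_zero z.1.2, zero_add]
          rfl
        rw [Pi.mul_apply, h1, h2, ← ENNReal.ofReal_mul (by positivity),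
          ← ENNReal.ofReal_mul (by positivity), ← ENNReal.ofReal_mul (by positivity)]
        congr 1
        rw [show -(‖z.1‖ ^ 2 + ‖z.2‖ ^ 2) / (v : ℝ) = -‖z.1‖ ^ 2 / v + -‖z.2‖ ^ 2 / v by ring,
          Real.exp_add]
        ring
      rw [lintegral_congr hpt, lintegral_prod_mul
        (f := fun u : V => ENNReal.ofReal ((Real.pi * v)⁻¹ ^ m)
          * ENNReal.ofReal (Real.exp (-‖u‖ ^ 2 / v)))
        (g := fun w : Vᗮ => ENNReal.ofReal ((‖w‖ ^ 2) ^ (-s) * Real.exp (-‖w‖ ^ 2 / v)))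
        (by fun_prop) (by fun_prop),
        lintegral_const_mul _ (by fun_prop), hrad]
      simp only [ENNReal.smul_def, smul_eq_mul]
      ring
    · exact (Measurable.mul (by fun_prop) (hmeas s))
  have hdpos : (0 : ℝ) < (m : ℝ) - k := by
    have : (k : ℝ) < m := by exact_mod_cast hk
    linarith
  have hG := Real.Gamma_pos_of_pos hdpos
  have h0 := hQ 0 hdpos
  simp only [neg_zero, Real.rpow_zero, ENNReal.ofReal_one, lintegral_one, measure_univ,
    sub_zero] at h0
  have hQ' : Q = ENNReal.ofReal ((v : ℝ) ^ ((m : ℝ) - k) * Real.Gamma ((m : ℝ) - k))⁻¹ := by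
    rw [ENNReal.ofReal_inv_of_pos (by positivity)]
    exact ENNReal.eq_inv_of_mul_eq_one_left h0.symm
  rw [hQ s hs, hQ', ← ENNReal.ofReal_mul (by positivity)]
  congr 1
  rw [show (m : ℝ) - k - s = -s + ((m : ℝ) - k) by ring, Real.rpow_add hv']
  have := Real.rpow_pos_of_pos hv' ((m : ℝ) - k)
  field_simp

/-! ### Gram determinants of Gaussian rows -/

/-- The real number `det (X Xᴴ)`. -/
def gramDet {n m : ℕ} (X : Fin n → Fin m → ℂ) : ℝ :=
  (Matrix.of X * (Matrix.of X)ᴴ).det.re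

/-- The real number `Tr (X Xᴴ)`, the squared Frobenius norm of `X`. -/
def gramTrace {n m : ℕ} (X : Fin n → Fin m → ℂ) : ℝ := ∑ i, ∑ j, ‖X i j‖ ^ 2

lemma trace_mul_conjTranspose_re {n m : ℕ} (X : Fin n → Fin m → ℂ) :
    (Matrix.of X * (Matrix.of X)ᴴ).trace.re = gramTrace X := by
  simp only [Matrix.trace, Matrix.diag_apply, Matrix.mul_apply, Matrix.conjTranspose_apply,
    Matrix.of_apply, Complex.re_sum, gramTrace]
  refine Finset.sum_congr rfl fun i _ => Finset.sum_congr rfl fun j _ => ?_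
  rw [← Complex.normSq_eq_norm_sq, RCLike.star_def, Complex.mul_conj, Complex.ofReal_re]

open scoped ComplexOrder in
lemma gramDet_nonneg {n m : ℕ} (X : Fin n → Fin m → ℂ) : 0 ≤ gramDet X :=
  (Complex.le_def.mp (Matrix.posSemidef_self_mul_conjTranspose (Matrix.of X)).det_nonneg).1

lemma gramTrace_nonneg {n m : ℕ} (X : Fin n → Fin m → ℂ) : 0 ≤ gramTrace X := by
  unfold gramTrace; positivity

lemma continuous_gramDet {n m : ℕ} : Continuous (gramDet : (Fin n → Fin m → ℂ) → ℝ) := by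
  have h : Continuous fun X : Fin n → Fin m → ℂ => Matrix.of X :=
    continuous_id
  exact Complex.continuous_re.comp (h.matrix_mul h.matrix_conjTranspose).matrix_det

lemma continuous_gramTrace {n m : ℕ} : Continuous (gramTrace : (Fin n → Fin m → ℂ) → ℝ) := by
  unfold gramTrace; fun_prop

@[fun_prop]
lemma measurable_gramDet {n m : ℕ} : Measurable (gramDet : (Fin n → Fin m → ℂ) → ℝ) :=
  continuous_gramDet.measurable

@[fun_prop]
lemma measurable_gramTrace {n m : ℕ} : Measurable (gramTrace : (Fin n → Fin m → ℂ) → ℝ) :=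
  continuous_gramTrace.measurable

/-- The span of the rows. -/
def rowSpan {n m : ℕ} (Y : Fin n → Fin m → ℂ) : Submodule ℂ (EuclideanSpace ℂ (Fin m)) :=
  Submodule.span ℂ (Set.range fun i => WithLp.toLp 2 (Y i))

/-- Base times height: adding a row multiplies the Gram determinant by the squared distance of
the new row to the span of the others. -/
lemma gramDet_cons {n m : ℕ} (x : Fin m → ℂ) (Y : Fin n → Fin m → ℂ) :
    gramDet (Fin.cons x Y : Fin (n + 1) → Fin m → ℂ)
      = ‖(rowSpan Y)ᗮ.starProjection (WithLp.toLp 2 x)‖ ^ 2 * gramDet Y := by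
  set V := rowSpan Y with hV
  set w := Vᗮ.starProjection (WithLp.toLp 2 x) with hw
  have hwV : w ∈ Vᗮ := Submodule.starProjection_apply_mem _ _
  have hxw : WithLp.toLp 2 x = V.starProjection (WithLp.toLp 2 x) + w :=
    (V.starProjection_add_starProjection_orthogonal _).symm
  obtain ⟨a, ha⟩ := (Submodule.mem_span_range_iff_exists_fun ℂ).mp
    (Submodule.starProjection_apply_mem V (WithLp.toLp 2 x))
  set L : Matrix (Fin (n + 1)) (Fin (n + 1)) ℂ :=
    Matrix.of (Fin.cons (Fin.cons 1 a) fun i => Fin.cons 0 ((1 : Matrix (Fin n) (Fin n) ℂ) i))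
    with hL
  set X' : Matrix (Fin (n + 1)) (Fin m) ℂ := Matrix.of (Fin.cons w.ofLp Y) with hX'
  have hX : Matrix.of (Fin.cons x Y : Fin (n + 1) → Fin m → ℂ) = L * X' := by
    ext i j
    refine Fin.cases ?_ (fun i => ?_) i
    · have h1 := congrArg (fun z : EuclideanSpace ℂ (Fin m) => z j) hxw
      rw [← ha] at h1
      simp [Matrix.mul_apply, Fin.sum_univ_succ, hL, hX'] at h1 ⊢
      rw [h1, add_comm]
    · simp [Matrix.mul_apply, Fin.sum_univ_succ, hL, hX', Matrix.one_apply]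
  have hdetL : L.det = 1 := by
    have h1 : L.submatrix Fin.succ Fin.succ = 1 := by
      ext i j
      simp [hL]
    rw [Matrix.det_succ_column_zero, Fin.sum_univ_succ]
    have h2 : ∀ i : Fin n, L i.succ 0 = 0 := fun i => by simp [hL]
    simp only [h2, mul_zero, zero_mul, Finset.sum_const_zero, add_zero]
    rw [show (Fin.succAbove (0 : Fin (n + 1))) = Fin.succ from rfl, h1]
    simp [hL]
  have hdetX' : (X' * X'ᴴ).det
      = ((‖w‖ ^ 2 : ℝ) : ℂ) * (Matrix.of Y * (Matrix.of Y)ᴴ).det := by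
    have h0 : (X' * X'ᴴ) 0 0 = ((‖w‖ ^ 2 : ℝ) : ℂ) := by
      rw [EuclideanSpace.norm_sq_eq]
      simp [Matrix.mul_apply, hX', Complex.mul_conj, Complex.normSq_eq_norm_sq]
    have h1 : ∀ i : Fin n, (X' * X'ᴴ) 0 i.succ = 0 := by
      intro i
      have hi : WithLp.toLp 2 (Y i) ∈ V := Submodule.subset_span (Set.mem_range_self i)
      have h2 : inner ℂ (WithLp.toLp 2 (Y i)) w = 0 :=
        Submodule.inner_right_of_mem_orthogonal hi hwV
      rw [PiLp.inner_apply] at h2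
      simpa [Matrix.mul_apply, hX'] using h2
    have h3 : (X' * X'ᴴ).submatrix Fin.succ Fin.succ = Matrix.of Y * (Matrix.of Y)ᴴ := by
      ext i j
      simp [Matrix.mul_apply, hX']
    rw [Matrix.det_succ_row_zero, Fin.sum_univ_succ]
    simp only [h1, mul_zero, zero_mul, Finset.sum_const_zero, add_zero, h0]
    rw [show (Fin.succAbove (0 : Fin (n + 1))) = Fin.succ from rfl, h3]
    simp
  rw [gramDet, gramDet, hX, Matrix.conjTranspose_mul, ← Matrix.mul_assoc, Matrix.mul_assoc L,
    Matrix.det_mul, Matrix.det_mul, Matrix.det_conjTranspose, hdetL, hdetX', star_one, mul_one,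
    one_mul, Complex.re_ofReal_mul]

/-- The Gram determinant of linearly dependent rows vanishes. -/
lemma gramDet_eq_zero_of_not_linearIndependent {n m : ℕ} {Y : Fin n → Fin m → ℂ}
    (h : ¬ LinearIndependent ℂ fun i => (WithLp.toLp 2 (Y i) : EuclideanSpace ℂ (Fin m))) :
    gramDet Y = 0 := by
  rw [Fintype.not_linearIndependent_iff] at h
  obtain ⟨g, hg, i, hi⟩ := h
  have hgY : g ᵥ* (Matrix.of Y) = 0 := by
    funext j
    have := congrArg (fun z : EuclideanSpace ℂ (Fin m) => z j) hg
    simpa [Matrix.vecMul, dotProduct] using this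
  have hdet : (Matrix.of Y * (Matrix.of Y)ᴴ).det = 0 := by
    rw [← Matrix.exists_vecMul_eq_zero_iff]
    exact ⟨g, fun h0 => hi (by rw [h0]; rfl), by rw [← Matrix.vecMul_vecMul, hgY, Matrix.zero_vecMul]⟩
  rw [gramDet, hdet, Complex.zero_re]

/-- The negative moments of `det (X Xᴴ)`, a product of independent Gamma variables. -/
lemma lintegral_rpow_gramDet {m : ℕ} {v : ℝ≥0} (hv : 0 < v) {s : ℝ} (hs0 : s ≠ 0) (n : ℕ)
    (hn : n ≤ m) (hs : s < (m : ℝ) - n + 1) :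
    ∫⁻ X, ENNReal.ofReal (gramDet X ^ (-s)) ∂(complexGaussianMatrix n m v)
      = ENNReal.ofReal (∏ k ∈ Finset.range n,
        ((v : ℝ) ^ (-s) * Real.Gamma ((m : ℝ) - k - s) / Real.Gamma ((m : ℝ) - k))) := by
  have hv' : (0 : ℝ) < v := by exact_mod_cast hv
  induction n with
  | zero => simp [gramDet]
  | succ n ih =>
    push_cast at hs
    have hnm : (n : ℝ) + 1 ≤ m := by exact_mod_cast hn
    have ih' := ih (by omega) (by linarith)
    have hmp := measurePreserving_piFinSuccAbove
      (fun _ : Fin (n + 1) => Measure.pi fun _ : Fin m => complexGaussian v) 0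
    have hpt : ∀ z : (Fin m → ℂ) × (Fin n → Fin m → ℂ),
        ENNReal.ofReal (gramDet ((MeasurableEquiv.piFinSuccAbove
          (fun _ : Fin (n + 1) => Fin m → ℂ) 0).symm z) ^ (-s))
        = ENNReal.ofReal ((‖(rowSpan z.2)ᗮ.starProjection (WithLp.toLp 2 z.1)‖ ^ 2) ^ (-s))
          * ENNReal.ofReal (gramDet z.2 ^ (-s)) := by
      intro z
      have e : (MeasurableEquiv.piFinSuccAbove (fun _ : Fin (n + 1) => Fin m → ℂ) 0).symm z
          = (Fin.cons z.1 z.2 : Fin (n + 1) → Fin m → ℂ) := by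
        rw [← Fin.insertNth_zero']; rfl
      rw [e, gramDet_cons, Real.mul_rpow (by positivity) (gramDet_nonneg _),
        ENNReal.ofReal_mul (by positivity)]
    have hint : ∀ Y : Fin n → Fin m → ℂ,
        ∫⁻ x, ENNReal.ofReal ((‖(rowSpan Y)ᗮ.starProjection (WithLp.toLp 2 x)‖ ^ 2) ^ (-s))
          * ENNReal.ofReal (gramDet Y ^ (-s)) ∂(Measure.pi fun _ : Fin m => complexGaussian v)
        = ENNReal.ofReal (gramDet Y ^ (-s)) * ENNReal.ofReal ((v : ℝ) ^ (-s) *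
          Real.Gamma ((m : ℝ) - n - s) / Real.Gamma ((m : ℝ) - n)) := by
      intro Y
      by_cases hY : LinearIndependent ℂ fun i => (WithLp.toLp 2 (Y i) : EuclideanSpace ℂ (Fin m))
      · rw [lintegral_mul_const' _ _ ENNReal.ofReal_ne_top, mul_comm]
        congr 1
        refine lintegral_rpow_norm_starProjection (rowSpan Y) ?_ (by omega) hv (by linarith)
        rw [rowSpan, finrank_span_eq_card hY, Fintype.card_fin]
      · -- here `0 ^ (-s) = 0` makes both sides vanish
        simp [gramDet_eq_zero_of_not_linearIndependent hY, Real.zero_rpow (neg_ne_zero.mpr hs0)]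
    have hmeas : Measurable fun z : (Fin m → ℂ) × (Fin n → Fin m → ℂ) =>
        ENNReal.ofReal (gramDet ((MeasurableEquiv.piFinSuccAbove
          (fun _ : Fin (n + 1) => Fin m → ℂ) 0).symm z) ^ (-s)) := by
      have := (measurable_gramDet (n := n + 1) (m := m)).comp
        (MeasurableEquiv.piFinSuccAbove (fun _ : Fin (n + 1) => Fin m → ℂ) 0).symm.measurable
      exact (this.pow_const _).ennreal_ofReal
    rw [complexGaussianMatrix, ← hmp.symm.lintegral_comp_emb (MeasurableEquiv.measurableEmbedding _),
      lintegral_prod_symm _ hmeas.aemeasurable]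
    simp only [hpt, hint]
    rw [lintegral_mul_const _ (by fun_prop), Finset.prod_range_succ, ENNReal.ofReal_mul, ← ih']
    · rfl
    · refine Finset.prod_nonneg fun k hk => ?_
      have hk' : (k : ℝ) + 1 ≤ n := by exact_mod_cast Finset.mem_range.mp hk
      exact div_nonneg (mul_nonneg (by positivity) (Real.Gamma_pos_of_pos (by linarith)).le)
        (Real.Gamma_pos_of_pos (by linarith)).le

/-! ### Homogeneity: separating trace and determinant -/

open Module in
lemma lintegral_comp_pos_smul {E : Type*} [NormedAddCommGroup E] [NormedSpace ℝ E]
    [FiniteDimensional ℝ E] [MeasurableSpace E] [BorelSpace E] (μ : Measure E)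
    [μ.IsAddHaarMeasure] {F : E → ENNReal} (hF : Measurable F) {t : ℝ} (ht : 0 < t) :
    ∫⁻ X, F (t • X) ∂μ = ENNReal.ofReal ((t ^ finrank ℝ E)⁻¹) * ∫⁻ X, F X ∂μ := by
  have h := Measure.map_addHaar_smul μ ht.ne'
  rw [abs_of_pos (by positivity)] at h
  rw [← smul_eq_mul, ← lintegral_smul_measure, ← h, lintegral_map hF (measurable_const_smul t)]

lemma lintegral_Ioi_one_exp {a : ℝ} (ha : 0 < a) :
    ∫⁻ l in Set.Ioi (1 : ℝ), ENNReal.ofReal (Real.exp (-a * l))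
      = ENNReal.ofReal (a⁻¹ * Real.exp (-a)) := by
  rw [← ofReal_integral_eq_lintegral_ofReal
    (integrableOn_exp_mul_Ioi (by linarith : -a < 0) 1)
    (Filter.Eventually.of_forall fun l => (Real.exp_pos _).le),
    integral_exp_mul_Ioi (by linarith : -a < 0)]
  congr 1
  rw [mul_one]
  field_simp

lemma lintegral_Ioi_one_rpow {a : ℝ} (ha : a < -1) :
    ∫⁻ l in Set.Ioi (1 : ℝ), ENNReal.ofReal (l ^ a) = ENNReal.ofReal (-(a + 1))⁻¹ := by
  rw [← ofReal_integral_eq_lintegral_ofReal (integrableOn_Ioi_rpow_of_lt ha one_pos)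
    ((ae_restrict_mem measurableSet_Ioi).mono fun l (hl : 1 < l) => by
      have : (0 : ℝ) < l := by linarith
      positivity), integral_Ioi_rpow_of_lt ha one_pos]
  congr 1
  rw [Real.one_rpow, neg_div, inv_neg, one_div]

open Module in
/-- Under a Gaussian weight `exp (-q / v)` the radial part is independent of the direction:
for `f` homogeneous of degree `-2k`, dividing by `q` divides the integral by `v (M - k - 1)`,
where `2M` is the dimension. It follows from `v / q * exp (-q / v) = ∫_{l > 1} exp (-l q / v)` by
rescaling. -/
lemma lintegral_div_mul_exp {E : Type*} [NormedAddCommGroup E] [NormedSpace ℝ E]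
    [FiniteDimensional ℝ E] [MeasurableSpace E] [BorelSpace E] (μ : Measure E)
    [μ.IsAddHaarMeasure] {M k : ℕ} (hM : finrank ℝ E = 2 * M) (hk : k + 1 < M) {v : ℝ} (hv : 0 < v)
    {q : E → ℝ} (hq : Measurable q) (hq0 : ∀ X, 0 ≤ q X)
    (hqt : ∀ (t : ℝ) X, q (t • X) = t ^ 2 * q X)
    {f : E → ENNReal} (hf : Measurable f) (hfq : ∀ X, q X = 0 → f X = 0)
    (hft : ∀ (t : ℝ) X, 0 < t → f X = ENNReal.ofReal (t ^ (2 * k)) * f (t • X)) :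
    ∫⁻ X, f X * ENNReal.ofReal (Real.exp (-q X / v)) ∂μ
      = ENNReal.ofReal (v * ((M : ℝ) - k - 1)) *
        ∫⁻ X, f X * ENNReal.ofReal (q X)⁻¹ * ENNReal.ofReal (Real.exp (-q X / v)) ∂μ := by
  have hMk : (0 : ℝ) < (M : ℝ) - k - 1 := by
    have : (k : ℝ) + 1 < M := by exact_mod_cast hk
    linarith
  have h1 : ∀ X, ENNReal.ofReal v * (f X * ENNReal.ofReal (q X)⁻¹ *
      ENNReal.ofReal (Real.exp (-q X / v)))
      = ∫⁻ l in Set.Ioi (1 : ℝ), f X * ENNReal.ofReal (Real.exp (-(q X / v) * l)) := by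
    intro X
    rcases (hq0 X).eq_or_lt with h | h
    · simp [hfq X h.symm]
    · rw [lintegral_const_mul _ (by fun_prop), lintegral_Ioi_one_exp (by positivity), inv_div,
        mul_comm, mul_assoc, mul_assoc, ← ENNReal.ofReal_mul (by positivity),
        ← ENNReal.ofReal_mul (by positivity)]
      congr 2
      rw [neg_div]
      ring
  set I := ∫⁻ X, f X * ENNReal.ofReal (Real.exp (-q X / v)) ∂μ with hI
  have h2 : ∀ l ∈ Set.Ioi (1 : ℝ),
      ∫⁻ X, f X * ENNReal.ofReal (Real.exp (-(q X / v) * l)) ∂μ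
        = ENNReal.ofReal (l ^ ((k : ℝ) - M)) * I := by
    intro l hl
    have hl0 : (0 : ℝ) < l := zero_lt_one.trans hl
    have ht : 0 < √l := Real.sqrt_pos.mpr hl0
    have ht2 : √l ^ 2 = l := Real.sq_sqrt hl0.le
    have h3 : ∀ X, f X * ENNReal.ofReal (Real.exp (-(q X / v) * l))
        = ENNReal.ofReal (l ^ k) * (f (√l • X) * ENNReal.ofReal (Real.exp (-q (√l • X) / v))) := by
      intro X
      rw [hft (√l) X ht, hqt, ht2, pow_mul, ht2, mul_assoc]
      congr 4
      ring
    simp only [h3]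
    rw [lintegral_const_mul' _ _ ENNReal.ofReal_ne_top, lintegral_comp_pos_smul μ
      (F := fun X => f X * ENNReal.ofReal (Real.exp (-q X / v))) (by fun_prop) ht, hM, pow_mul, ht2,
      ← mul_assoc, ← ENNReal.ofReal_mul (by positivity), Real.rpow_sub hl0, Real.rpow_natCast,
      Real.rpow_natCast]
    rfl
  have h4 : ENNReal.ofReal v * ∫⁻ X, f X * ENNReal.ofReal (q X)⁻¹ *
      ENNReal.ofReal (Real.exp (-q X / v)) ∂μ = ENNReal.ofReal ((M : ℝ) - k - 1)⁻¹ * I := by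
    rw [← lintegral_const_mul' _ _ ENNReal.ofReal_ne_top, lintegral_congr h1,
      lintegral_lintegral_swap (by fun_prop), setLIntegral_congr_fun measurableSet_Ioi h2,
      lintegral_mul_const _ (by fun_prop), lintegral_Ioi_one_rpow (by linarith)]
    congr 3
    ring
  rw [mul_comm v, ENNReal.ofReal_mul hMk.le, mul_assoc, h4, ← mul_assoc,
    ← ENNReal.ofReal_mul hMk.le, mul_inv_cancel₀ hMk.ne', ENNReal.ofReal_one, one_mul]

lemma gramTrace_smul {n m : ℕ} (t : ℝ) (X : Fin n → Fin m → ℂ) :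
    gramTrace (t • X) = t ^ 2 * gramTrace X := by
  simp only [gramTrace, Pi.smul_apply, norm_smul, mul_pow, Finset.mul_sum, Real.norm_eq_abs, sq_abs]

lemma gramDet_smul {n m : ℕ} (t : ℝ) (X : Fin n → Fin m → ℂ) :
    gramDet (t • X) = (t ^ 2) ^ n * gramDet X := by
  have h : Matrix.of (t • X) * (Matrix.of (t • X))ᴴ
      = ((t ^ 2 : ℝ) : ℂ) • (Matrix.of X * (Matrix.of X)ᴴ) := by
    ext i j
    simp only [Matrix.mul_apply, Matrix.conjTranspose_apply, Matrix.of_apply, Pi.smul_apply,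
      Matrix.smul_apply, smul_eq_mul, Finset.mul_sum, Complex.real_smul, star_mul',
      RCLike.star_def, Complex.conj_ofReal]
    exact Finset.sum_congr rfl fun _ _ => by push_cast; ring
  rw [gramDet, h, Matrix.det_smul, Fintype.card_fin, ← Complex.ofReal_pow, Complex.re_ofReal_mul,
    gramDet]

lemma gramDet_eq_zero_of_gramTrace_eq_zero {n m : ℕ} (hn : 0 < n) {X : Fin n → Fin m → ℂ}
    (h : gramTrace X = 0) : gramDet X = 0 := by
  have hX : X = 0 := by
    funext i j
    rw [gramTrace, Finset.sum_eq_zero_iff_of_nonneg fun _ _ => by positivity] at h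
    have h1 := h i (Finset.mem_univ i)
    rw [Finset.sum_eq_zero_iff_of_nonneg fun _ _ => by positivity] at h1
    simpa using h1 j (Finset.mem_univ j)
  have := gramDet_smul 0 X
  rw [zero_smul, zero_pow two_ne_zero, zero_pow hn.ne', zero_mul] at this
  rwa [hX]

open Module in
lemma finrank_complexMatrix (n m : ℕ) : finrank ℝ (Fin n → Fin m → ℂ) = 2 * (n * m) := by
  rw [Module.finrank_pi_fintype]
  simp [Module.finrank_pi_fintype]
  ring

/-- Moments of `(Tr X Xᴴ)^p / det (X Xᴴ)^(p / n)`, which is homogeneous of degree `0`. -/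
lemma lintegral_gramTrace_pow_mul {n m p : ℕ} (hn : 0 < n) (hp : p < n * m) {v : ℝ≥0}
    (hv : 0 < v) (hp0 : p ≠ 0) :
    ∫⁻ X, ENNReal.ofReal (gramTrace X ^ p * gramDet X ^ (-((p : ℝ) / n)))
        ∂(complexGaussianMatrix n m v)
      = ENNReal.ofReal (∏ k ∈ Finset.Icc 1 p, ((v : ℝ) * ((n : ℝ) * m - k))) *
        ∫⁻ X, ENNReal.ofReal (gramDet X ^ (-((p : ℝ) / n))) ∂(complexGaussianMatrix n m v) := by
  have hv' : (0 : ℝ) < v := by exact_mod_cast hv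
  have hn' : (0 : ℝ) < n := by exact_mod_cast hn
  set s : ℝ := (p : ℝ) / n with hs
  have hs0 : -s ≠ 0 := by
    rw [hs]; exact neg_ne_zero.mpr (by positivity)
  set J : ℕ → ENNReal := fun k => ∫⁻ X : Fin n → Fin m → ℂ,
    ENNReal.ofReal (gramTrace X ^ (p - k) * gramDet X ^ (-s)) *
      ENNReal.ofReal (Real.exp (-gramTrace X / v)) with hJ
  have hmeas : ∀ k, Measurable fun X : Fin n → Fin m → ℂ =>
      ENNReal.ofReal (gramTrace X ^ k * gramDet X ^ (-s)) := fun k => by fun_prop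
  have hstep : ∀ k, k < p → J k = ENNReal.ofReal ((v : ℝ) * ((n : ℝ) * m - (k + 1 : ℕ))) *
      J (k + 1) := by
    intro k hk
    have : (volume : Measure (Fin n → Fin m → ℂ)).IsAddHaarMeasure :=
      Measure.pi.isAddHaarMeasure _
    have h := lintegral_div_mul_exp (volume : Measure (Fin n → Fin m → ℂ))
      (finrank_complexMatrix n m) (k := k) (by omega) hv' measurable_gramTrace gramTrace_nonneg
      gramTrace_smul (hmeas (p - k))
      (fun X hX => by
        rw [gramDet_eq_zero_of_gramTrace_eq_zero hn hX, Real.zero_rpow hs0, mul_zero,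
          ENNReal.ofReal_zero])
      (fun t X ht => by
        rw [← ENNReal.ofReal_mul (pow_nonneg ht.le _), gramTrace_smul, gramDet_smul,
          Real.mul_rpow (by positivity) (gramDet_nonneg X), ← Real.rpow_natCast (t ^ 2) n,
          ← Real.rpow_mul (by positivity), mul_neg, hs, mul_div_cancel₀ _ hn'.ne',
          Real.rpow_neg (x := t ^ 2) (by positivity), Real.rpow_natCast]
        congr 1
        have e : (t ^ 2) ^ p = t ^ (2 * k) * (t ^ 2) ^ (p - k) := by
          rw [pow_mul, ← pow_add]; congr 1; omega
        rw [e, mul_pow]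
        have := ht.ne'
        field_simp)
    rw [hJ]
    simp only
    rw [h]
    congr 1
    · congr 2
      push_cast
      ring
    · refine lintegral_congr fun X => ?_
      rw [← ENNReal.ofReal_mul (mul_nonneg (pow_nonneg (gramTrace_nonneg X) _)
        (Real.rpow_nonneg (gramDet_nonneg X) _))]
      congr 2
      rcases (gramTrace_nonneg X).eq_or_lt with h0 | h0
      · rw [gramDet_eq_zero_of_gramTrace_eq_zero hn h0.symm, Real.zero_rpow hs0]
        simp
      · rw [show p - k = p - (k + 1) + 1 by omega, pow_succ]
        field_simp
  have hall : ∀ k, k ≤ p → J 0 = ENNReal.ofReal (∏ j ∈ Finset.Icc 1 k,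
      ((v : ℝ) * ((n : ℝ) * m - j))) * J k := by
    intro k
    induction k with
    | zero => simp
    | succ k ih =>
      intro hk
      rw [ih (by omega), hstep k (by omega), Finset.prod_Icc_succ_top (by omega), ← mul_assoc,
        ← ENNReal.ofReal_mul]
      refine Finset.prod_nonneg fun j hj => mul_nonneg hv'.le ?_
      have h1 : j ≤ n * m := by have := (Finset.mem_Icc.mp hj).2; omega
      have h2 : (j : ℝ) ≤ n * m := by exact_mod_cast h1
      linarith
  have hE : ∀ k, ∫⁻ X, ENNReal.ofReal (gramTrace X ^ (p - k) * gramDet X ^ (-s))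
        ∂(complexGaussianMatrix n m v) = ENNReal.ofReal (((Real.pi * v)⁻¹ ^ m) ^ n) * J k := by
    intro k
    rw [complexGaussianMatrix_eq_withDensity n m hv, lintegral_withDensity_eq_lintegral_mul _
      (by fun_prop) (hmeas _), hJ, ← lintegral_const_mul' _ _ ENNReal.ofReal_ne_top]
    refine lintegral_congr fun X => ?_
    rw [Pi.mul_apply, ENNReal.ofReal_mul (by positivity), mul_assoc]
    congr 1
    rw [mul_comm]
    rfl
  have e0 := hE 0
  have ep := hE p
  simp only [Nat.sub_zero, Nat.sub_self, pow_zero, one_mul] at e0 ep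
  rw [e0, ep, hall p le_rfl]
  ring

/-! ### The moments of the sphericity statistic -/

lemma sphericityStat_pow_eq {n m : ℕ} (p : ℕ) (X : Fin n → Fin m → ℂ) :
    sphericityStat (Matrix.of X) ^ p
      = ((n : ℝ) ^ p)⁻¹ * (gramTrace X ^ p * gramDet X ^ (-((p : ℝ) / n))) := by
  rw [sphericityStat, trace_mul_conjTranspose_re, ← gramDet, div_pow, div_pow,
    ← Real.rpow_mul_natCast (gramDet_nonneg X), Real.rpow_neg (gramDet_nonneg X),
    show 1 / (n : ℝ) * p = p / n by ring]
  ring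

lemma lintegral_sphericityStat_pow {n r p : ℕ} (hn : 0 < n) (hp0 : p ≠ 0) (hp : p < n * (r + 1))
    {v : ℝ≥0} (hv : 0 < v) :
    ∫⁻ X, ENNReal.ofReal (sphericityStat (Matrix.of X) ^ p) ∂(complexGaussianMatrix n (r + n) v)
      = ENNReal.ofReal (momentFormula p n r) := by
  have hv' : (0 : ℝ) < v := by exact_mod_cast hv
  have hn' : (0 : ℝ) < n := by exact_mod_cast hn
  have hs := div_lt_of_lt_mul hn hp
  have hs0 : (p : ℝ) / n ≠ 0 := by positivity
  have hpm : p < n * (r + n) := hp.trans_le (Nat.mul_le_mul_left n (by omega))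
  have hprod : 0 ≤ ∏ k ∈ Finset.Icc 1 p, ((v : ℝ) * ((n : ℝ) * (r + n : ℕ) - k)) := by
    refine Finset.prod_nonneg fun k hk => mul_nonneg hv'.le ?_
    have h1 : k ≤ n * (r + n) := (Finset.mem_Icc.mp hk).2.trans hpm.le
    have h2 : (k : ℝ) ≤ (n : ℝ) * (r + n : ℕ) := by exact_mod_cast h1
    linarith
  simp only [sphericityStat_pow_eq]
  simp only [ENNReal.ofReal_mul (inv_nonneg.mpr (pow_nonneg hn'.le p))]
  rw [lintegral_const_mul' _ _ ENNReal.ofReal_ne_top, lintegral_gramTrace_pow_mul hn hpm hv hp0,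
    lintegral_rpow_gramDet hv hs0 n (by omega) (by push_cast; linarith),
    ← ENNReal.ofReal_mul hprod, ← ENNReal.ofReal_mul (by positivity)]
  congr 1
  -- the powers of the variance cancel
  have h1 : ∏ k ∈ Finset.Icc 1 p, ((v : ℝ) * ((n : ℝ) * (r + n : ℕ) - k))
      = (v : ℝ) ^ p * ((n : ℝ) ^ p * ∏ k ∈ Finset.Icc 1 p, (((r + n : ℕ) : ℝ) - (k : ℝ) / n)) := by
    have h2 : ∀ a : ℝ, a ^ p = ∏ _k ∈ Finset.Icc 1 p, a := fun a => by simp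
    rw [h2, h2, ← Finset.prod_mul_distrib, ← Finset.prod_mul_distrib]
    refine Finset.prod_congr rfl fun k _ => ?_
    field_simp
  have h3 : ∏ k ∈ Finset.range n, ((v : ℝ) ^ (-((p : ℝ) / n)) *
        Real.Gamma (((r + n : ℕ) : ℝ) - k - (p : ℝ) / n) / Real.Gamma (((r + n : ℕ) : ℝ) - k))
      = ((v : ℝ) ^ p)⁻¹ * ∏ i ∈ Finset.range n,
        Real.Gamma ((r + i : ℕ) + 1 - (p : ℝ) / n) / Real.Gamma ((r + i : ℕ) + 1) := by
    have h4 : ((v : ℝ) ^ p)⁻¹ = ∏ _k ∈ Finset.range n, (v : ℝ) ^ (-((p : ℝ) / n)) := by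
      rw [Finset.prod_const, Finset.card_range, ← Real.rpow_mul_natCast hv'.le, neg_mul,
        div_mul_cancel₀ _ hn'.ne', Real.rpow_neg hv'.le, Real.rpow_natCast]
    rw [h4, ← Finset.prod_range_reflect
      (fun i => Real.Gamma ((r + i : ℕ) + 1 - (p : ℝ) / n) / Real.Gamma ((r + i : ℕ) + 1)),
      ← Finset.prod_mul_distrib]
    refine Finset.prod_congr rfl fun k hk => ?_
    have hk' := Finset.mem_range.mp hk
    have e : ((r + (n - 1 - k) : ℕ) : ℝ) + 1 = ((r + n : ℕ) : ℝ) - k := by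
      rw [eq_sub_iff_add_eq]
      exact_mod_cast (by omega : r + (n - 1 - k) + 1 + k = r + n)
    rw [e, mul_div_assoc]
  rw [h1, h3, momentFormula]
  field_simp

lemma measurable_sphericityStat_pow {n m : ℕ} (p : ℕ) :
    Measurable fun X : Fin n → Fin m → ℂ => sphericityStat (Matrix.of X) ^ p := by
  simp only [sphericityStat_pow_eq]
  fun_prop

lemma sphericityStat_pow_nonneg {n m : ℕ} (p : ℕ) (X : Fin n → Fin m → ℂ) :
    0 ≤ sphericityStat (Matrix.of X) ^ p := by
  rw [sphericityStat_pow_eq]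
  exact mul_nonneg (by positivity) (mul_nonneg (pow_nonneg (gramTrace_nonneg X) _)
    (Real.rpow_nonneg (gramDet_nonneg X) _))

lemma integrable_sphericityStat_pow {n r p : ℕ} (hn : 0 < n) (hp0 : p ≠ 0) (hp : p < n * (r + 1))
    {v : ℝ≥0} (hv : 0 < v) :
    Integrable (fun X : Fin n → Fin (r + n) → ℂ => sphericityStat (Matrix.of X) ^ p)
      (complexGaussianMatrix n (r + n) v) := by
  refine ⟨(measurable_sphericityStat_pow p).aestronglyMeasurable, ?_⟩
  rw [hasFiniteIntegral_iff_ofReal (Filter.Eventually.of_forall (sphericityStat_pow_nonneg p)),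
    lintegral_sphericityStat_pow hn hp0 hp hv]
  exact ENNReal.ofReal_lt_top

lemma momentW0_eq_momentFormula {n r p : ℕ} (hn : 0 < n) (hp0 : p ≠ 0) (hp : p < n * (r + 1))
    {v : ℝ≥0} (hv : 0 < v) : momentW0 n (r + n) v p = momentFormula p n r := by
  rw [momentW0, integral_eq_lintegral_of_nonneg_ae
    (Filter.Eventually.of_forall (sphericityStat_pow_nonneg p))
    (measurable_sphericityStat_pow p).aestronglyMeasurable,
    lintegral_sphericityStat_pow hn hp0 hp hv,
    ENNReal.toReal_ofReal (momentFormula_pos hn hp).le]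

/-- Writing `m = r + n` in the hypotheses on the dimensions. -/
lemma exists_eq_add_of_ratio {n m p : ℕ} (h0 : 0 < (n : ℝ) / m) (h1 : (n : ℝ) / m < 1)
    (hp : (p : ℤ) < n * ((m : ℤ) - n + 1)) :
    0 < n ∧ ∃ r, m = r + n ∧ p < n * (r + 1) := by
  have hn : 0 < n := by
    rcases Nat.eq_zero_or_pos n with rfl | h
    · simp at h0
    · exact h
  have hm : 0 < m := by
    rcases Nat.eq_zero_or_pos m with rfl | h
    · simp at h0
    · exact h
  have hnm : n ≤ m := by
    rw [div_lt_one (by exact_mod_cast hm)] at h1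
    exact_mod_cast h1.le
  obtain ⟨r, rfl⟩ := Nat.exists_eq_add_of_le' hnm
  refine ⟨hn, r, rfl, ?_⟩
  push_cast at hp
  rw [show (r : ℤ) + n - n + 1 = r + 1 by ring] at hp
  exact_mod_cast hp

end

theorem proposition1 (p : ℕ) (hp : 1 ≤ p) :
    (∀ (n m : ℕ) (N₀ : ℝ≥0), 0 < N₀ → 0 < (n : ℝ) / m → (n : ℝ) / m < 1 →
      (p : ℤ) < n * ((m : ℤ) - n + 1) →
      Integrable (fun X : Fin n → Fin m → ℂ => sphericityStat (Matrix.of X) ^ p)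
        (complexGaussianMatrix n m N₀)) ∧
    ∀ (a b : ℝ), 0 < a → b < 1 → ∀ N : ℕ, ∃ C : ℝ, ∀ (n m : ℕ) (N₀ : ℝ≥0) (c : ℝ),
      0 < N₀ → c = (n : ℝ) / m → a ≤ c → c ≤ b → (p : ℤ) < n * ((m : ℤ) - n + 1) →
      |momentW0 n m N₀ p - ∑ j ∈ Finset.range (N + 1), coeffBeta p c j / (n : ℝ) ^ (2 * j)|
          ≤ C / (n : ℝ) ^ (2 * (N + 1)) ∧
      |Real.log (momentW0 n m N₀ p)
            - ∑ q ∈ Finset.range (N + 1), coeffA p c q / (n : ℝ) ^ (2 * q)|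
          ≤ C / (n : ℝ) ^ (2 * (N + 1)) := by
  have hp0 : p ≠ 0 := by omega
  refine ⟨fun n m N₀ hN₀ h0 h1 hpn => ?_, fun a b ha hb N => ?_⟩
  · obtain ⟨hn, r, rfl, hlt⟩ := exists_eq_add_of_ratio h0 h1 hpn
    exact integrable_sphericityStat_pow hn hp0 hlt hN₀
  · obtain ⟨C, hC0, hC⟩ := abs_log_momentFormula_sub_le p N ha hb
    obtain ⟨C', hC'0, hC'⟩ := abs_sub_coeffBeta_le p N ha hb hC0
    refine ⟨max C C', fun n m N₀ c hN₀ hc hac hcb hpn => ?_⟩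
    have h0 : 0 < (n : ℝ) / m := hc ▸ ha.trans_le hac
    have h1 : (n : ℝ) / m < 1 := hc ▸ hcb.trans_lt hb
    obtain ⟨hn, r, rfl, hlt⟩ := exists_eq_add_of_ratio h0 h1 hpn
    rw [momentW0_eq_momentFormula hn hp0 hlt hN₀]
    have hlog := hC n r hn (hc ▸ hac) (hc ▸ hcb)
    rw [← hc] at hlog
    have hβ := hC' _ c n hn (momentFormula_pos hn hlt) hac hcb hlog
    exact ⟨hβ.trans (by gcongr; exact le_max_right _ _),
      hlog.trans (by gcongr; exact le_max_left _ _)⟩
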